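/- Let $(\mathcal X,\mathcal D)$ be a compact doubling metric space of diameter $\Delta>0$. Let $N$ be its doubling constant, i.e. the least number such that every closed ball of radius $r>0$ is covered by $N$ closed balls of radius $r/2$, and let $d=\log_2 N$ be its doubling dimension. Fix $L\ge\lambda>0$ and $q\ge 1$, and call $f:\mathcal X\to\mathbb R$ nondegenerate (with parameters $\lambda,L,q$) if it has a unique minimizer $x^*$ and $\lambda\,\mathcal D(x,x^*)^q\le f(x)-f(x^*)\le L\,\mathcal D(x,x^*)^q$ for all $x\in\mathcal X$. A policy plays $x_1,\dots,x_T$, and step $t$ has loss $y_t=f(x_t)+\xi_t$, where the $\xi_t$ are i.i.d., mean-zero and $1$-sub-Gaussian. Its regret is $R(T)=\sum_{t=1}^T (f(x_t)-f(x^*))$. It runs on a static communication grid $0=\tau_0<\tau_1<\dots<\tau_{M_s}\le T$ if each $x_t$ depends only on internal randomness and on the losses up to the last grid point before $t$. **The grid.** Put $\kappa=(\frac{\lambda+L}{\lambda})^{1/q}$, $B=2^{\lceil\log_2(3+2\kappa)\rceil}$, $\hat\eta=\frac{q+d}{2q+d}$, $\hat c_1=\frac{1}{2(2q+d)\log 2}\log\frac{T}{\log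 T}$ and $\hat c_{i+1}=\hat\eta\,\hat c_i$. The Rounded Radius sequence is $\bar r_{2k-1}=2^{-\lfloor \hat c_1+\dots+\hat c_k\rfloor}$, $\bar r_{2k}=2^{-\lceil \hat c_1+\dots+\hat c_k\rceil}$. Let $s_1=1$, $s_{m+1}=\inf\{k>m:\bar r_k\le\bar r_{s_m}\}$, $\rho_m=\Delta\,\bar r_{s_m}$, $n_m=\lceil 16\log T/(\lambda^2\rho_m^{2q})\rceil$, $b_1=(\frac{1}{2\bar r_1})^dB^d$, $b_{m+1}=(\bar r_{s_m}/\bar r_{s_{m+1}})^dB^d$, and $\tau_0=0$, $\tau_m=\tau_{m-1}+b_mn_m$. Finally $\hat M=\big\lceil \log\log\frac{T}{\log T}\,/\,\log\frac1{\hat\eta}\big\rceil$ and $M_s=\max\{m\le 2\hat M:\tau_m\le T\}$. The grid is $\{\tau_0,\dots,\tau_{M_s}\}$; it is fixed before any query is made. **The algorithm (Geometric Narrowing, GN, on the static grid).** Let $S_0=\mathcal X$. In batch $m=1,\dots,M_s$, i.e. in the steps $\tau_{m-1}<t\le\tau_m$, cover the remaining region $S_{m-1}$ by a collection $\mathcal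 A_m^{pre}$ of at most $b_m$ closed balls of radius $\rho_m$, each meeting $S_{m-1}$. One ball after the other, play the centre of each ball $n_m$ times, and let $\hat f_m(B)$ be the average of these losses. Spend the remaining steps of the batch anywhere in the balls of $\mathcal A_m^{pre}$. Let $B_m^{\min}$, with centre $x_m^{\min}$, be a ball of least $\hat f_m$. Keep the balls in $\mathcal A_m=\{B\in\mathcal A_m^{pre}:\sup_{x\in B}\mathcal D(x,x_m^{\min})\le(2+\kappa)\rho_m\}$, and let $S_m$ be their union. After $\tau_{M_s}$, play one point of $S_{M_s}$ until step $T$. Covers, ties, surplus queries and the last point may be chosen in any way that respects the grid. **Claim.** There are constants $K_+,A_+,C>0$, depending only on $\lambda,L,q,\Delta$ (in particular not on $d$ or $T$), such that for every such space and every $T\in\mathbb N_+$ the following hold. 1. $0=\tau_0<\tau_1<\dots<\tau_{M_s}\le T$, and if $T\ge 3$ then $M_s+1\le C\,(1+d)\log\log T$; so for a given space only $O(\log\log T)$ communication points are used. 2. GN can be run on this grid, and however this is done, for every nondegenerate $f$ with parameters $\lambda,L,q$, with probability exceeding $1-2T^{-1}$, $$R(T)\le K_+A_+^{d}\sqrt{T\log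 T}\,\log\log\frac{T}{\log T}.$$ -/

import Mathlib

open MeasureTheory ProbabilityTheory

noncomputable section

namespace StaticGN

/-! ### Doubling metric spaces and nondegenerate functions -/

/-- Every closed ball is covered by at most `N` closed balls (centred in the space) of half its
radius. -/
def HasDoublingBound (X : Type*) [MetricSpace X] (N : ℕ) : Prop :=
  ∀ (x : X) (r : ℝ), 0 < r → ∃ s : Finset X, s.card ≤ N ∧
    Metric.closedBall x r ⊆ ⋃ z ∈ s, Metric.closedBall z (r / 2)

/-- A metric space is doubling if its doubling constant is finite. -/
def IsDoubling (X : Type*) [MetricSpace X] : Prop := ∃ N : ℕ, HasDoublingBound X N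

/-- The doubling constant: the least admissible number of balls of half the radius. -/
def doublingConstant (X : Type*) [MetricSpace X] : ℕ := sInf {N : ℕ | HasDoublingBound X N}

/-- The doubling dimension `log₂ N`, where `N` is the doubling constant. -/
def doublingDim (X : Type*) [MetricSpace X] : ℝ := Real.logb 2 (doublingConstant X)

/-- `f` attains its minimum exactly at `xs`, and grows away from `xs` like the `q`-th power of the
distance, up to the factors `lam` and `L`. -/
structure IsNondegenerate {X : Type*} [MetricSpace X] (f : X → ℝ) (lam L q : ℝ) (xs : X) :
    Prop where
  unique_min : ∀ z : X, z ≠ xs → f xs < f z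
  lower : ∀ x : X, lam * dist x xs ^ q ≤ f x - f xs
  upper : ∀ x : X, f x - f xs ≤ L * dist x xs ^ q

/-- Independent, identically distributed, mean-zero, 1-sub-Gaussian noise. -/
structure IsNoise {Ω : Type*} [MeasurableSpace Ω] (μ : Measure Ω) (ξ : ℕ → Ω → ℝ) : Prop where
  measurable : ∀ t, Measurable (ξ t)
  indep : iIndepFun ξ μ
  ident : ∀ t, IdentDistrib (ξ t) (ξ 0) μ μ
  mean_zero : ∀ t, ∫ ω, ξ t ω ∂μ = 0
  subgaussian : ∀ t, HasSubgaussianMGF (ξ t) 1 μ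

/-! ### The static communication grid -/

/-- What is known before the first query: the nondegeneracy parameters, the diameter and the
doubling dimension of the space, and the time horizon. -/
structure Params where
  lam : ℝ
  L : ℝ
  q : ℝ
  diam : ℝ
  d : ℝ
  T : ℕ

namespace Params

variable (P : Params)

/-- `η̂ = (q + d) / (2 q + d)`. -/
def eta : ℝ := (P.q + P.d) / (2 * P.q + P.d)

/-- The sequence `ĉ₁, ĉ₂, …` (the value at `0` is not used). -/
def cHat : ℕ → ℝ
  | 0 => 0
  | 1 => 1 / (2 * (2 * P.q + P.d) * Real.log 2) * Real.log (P.T / Real.log P.T)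
  | (i + 2) => P.eta * cHat (i + 1)

/-- `ĉ₁ + ⋯ + ĉ_k`. -/
def cSum (k : ℕ) : ℝ := ∑ i ∈ Finset.Icc 1 k, P.cHat i

/-- The Rounded Radius sequence: `r̄_{2k-1} = 2 ^ (-⌊ĉ₁ + ⋯ + ĉ_k⌋)` and
`r̄_{2k} = 2 ^ (-⌈ĉ₁ + ⋯ + ĉ_k⌉)`. -/
def rr (m : ℕ) : ℝ :=
  if Even m then (2 : ℝ) ^ (-⌈P.cSum (m / 2)⌉) else (2 : ℝ) ^ (-⌊P.cSum ((m + 1) / 2)⌋)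

/-- `((λ + L) / λ) ^ (1 / q)`. -/
def kappa : ℝ := ((P.lam + P.L) / P.lam) ^ (1 / P.q)

/-- `[z]₂ = 2 ^ ⌈log₂ z⌉`. -/
def ceilTwo (z : ℝ) : ℝ := (2 : ℝ) ^ ⌈Real.logb 2 z⌉

/-- `B = [3 + 2 ((λ + L) / λ) ^ (1 / q)]₂`. -/
def bConst : ℝ := ceilTwo (3 + 2 * P.kappa)

/-- The RR-index `s_m` of the radius used in batch `m ≥ 1`. -/
def sIdx : ℕ → ℕ
  | 0 => 0
  | 1 => 1
  | (m + 2) => sInf {k : ℕ | m + 1 < k ∧ P.rr k ≤ P.rr (sIdx (m + 1))}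

/-- Radius of the balls in batch `m`, in the units of a space of diameter `P.diam` (for a space
of diameter one this is the RR radius itself). -/
def rad (m : ℕ) : ℝ := P.diam * P.rr (P.sIdx m)

/-- Number of queries per ball in batch `m`. -/
def reps (m : ℕ) : ℕ := ⌈16 * Real.log P.T / (P.lam ^ 2 * P.rad m ^ (2 * P.q))⌉₊

/-- Number of balls provided for in batch `m ≥ 1`. In a space of doubling dimension `P.d` the
numbers under the rounding signs are integers. -/
def ballCap : ℕ → ℕ
  | 0 => 0
  | 1 => ⌈(1 / (2 * P.rr (P.sIdx 1))) ^ P.d * P.bConst ^ P.d⌉₊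
  | (m + 2) => ⌈(P.rr (P.sIdx (m + 1)) / P.rr (P.sIdx (m + 2))) ^ P.d * P.bConst ^ P.d⌉₊

/-- The grid points `0 = τ₀, τ₁, τ₂, …`. -/
def tau : ℕ → ℕ
  | 0 => 0
  | (m + 1) => tau m + P.ballCap (m + 1) * P.reps (m + 1)

/-- `M̂ = log log (T / log T) / log (1 / η̂)`, rounded up. -/
def mHat : ℕ := ⌈Real.log (Real.log (P.T / Real.log P.T)) / Real.log (1 / P.eta)⌉₊

/-- Index of the last batch: the largest `m ≤ 2 M̂` with `τ_m ≤ T`. -/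
def lastBatch : ℕ := Nat.findGreatest (fun m => P.tau m ≤ P.T) (2 * P.mHat)

/-- The last point of the grid `τ₀, …, τ_{lastBatch}` strictly before step `t ≥ 1`. -/
def lastComm (t : ℕ) : ℕ := P.tau (Nat.findGreatest (fun m => P.tau m < t) P.lastBatch)

end Params

/-! ### Batched policies and their regret -/

/-- A (possibly randomized) policy: the point played at a given step, as a function of a random
seed and of the losses. -/
abbrev Policy (X U : Type*) := ℕ → U → (ℕ → ℝ) → X

/-- The batched feedback protocol on the static grid: what is played at step `t` depends on the
seed and on the losses up to the last grid point before `t` only. -/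
def RespectsGrid {X U : Type*} (P : Params) (π : Policy X U) : Prop :=
  ∀ (t : ℕ) (u : U) (y y' : ℕ → ℝ), 1 ≤ t →
    (∀ s, 1 ≤ s → s ≤ P.lastComm t → y s = y' s) → π t u y = π t u y'

/-- The losses generated by a policy with seed `u` on the expected loss `f` with noise `z`:
at step `t` the loss is `f (x_t) + z_t`, with `x_t` computed from the losses before `t`. -/
def losses {X U : Type*} (π : Policy X U) (f : X → ℝ) (u : U) (z : ℕ → ℝ) (t : ℕ) : ℝ :=
  f (π t u (fun s => if _h : s < t then losses π f u z s else 0)) + z t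
termination_by t

/-- The point played at step `t`. -/
def played {X U : Type*} (π : Policy X U) (f : X → ℝ) (u : U) (z : ℕ → ℝ) (t : ℕ) : X :=
  π t u (fun s => if s < t then losses π f u z s else 0)

/-- The `T`-step regret against the minimizer `xs`. -/
def regret {X U : Type*} (π : Policy X U) (f : X → ℝ) (xs : X) (u : U) (z : ℕ → ℝ) (T : ℕ) : ℝ :=
  ∑ t ∈ Finset.Icc 1 T, (f (played π f u z t) - f xs)

/-! ### Geometric Narrowing on the static grid -/

/-- The record of a run: in batch `m ≥ 1` the collection `𝒜_m^pre` consists of the `num m` balls of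
radius `P.rad m` with centres `cen m i`, `i < num m`; `best m` is the index of the ball of least
average loss. -/
structure Transcript (X : Type*) where
  num : ℕ → ℕ
  cen : ℕ → ℕ → X
  best : ℕ → ℕ

section

variable {X : Type*} [MetricSpace X] (P : Params) (tr : Transcript X)

/-- Ball number `i` of batch `m`. -/
def Transcript.ball (m i : ℕ) : Set X := Metric.closedBall (tr.cen m i) (P.rad m)

/-- The balls that survive batch `m` (the collection `𝒜_m`, as a set of indices). -/
def Transcript.kept (m : ℕ) : Set ℕ :=
  {i | i < tr.num m ∧
    ∀ x ∈ tr.ball P m i, dist x (tr.cen m (tr.best m)) ≤ (2 + P.kappa) * P.rad m}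

/-- The region not eliminated after batch `m`; it is the whole space at the start. -/
def Transcript.region : ℕ → Set X
  | 0 => Set.univ
  | (m + 1) => ⋃ i ∈ tr.kept P (m + 1), tr.ball P (m + 1) i

/-- The step of batch `m ≥ 1` in which ball `i` is queried for the `k`-th time (`i`, `k` from 0). -/
def queryTime (m i k : ℕ) : ℕ := P.tau (m - 1) + i * P.reps m + k + 1

/-- Average loss of ball `i` in batch `m`. -/
def avgLoss (y : ℕ → ℝ) (m i : ℕ) : ℝ :=
  (∑ k ∈ Finset.range (P.reps m), y (queryTime P m i k)) / P.reps m

/-- The points `x₁, x₂, …` follow Geometric Narrowing on the static grid when the losses are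
`y₁, y₂, …`. -/
structure FollowsGN (x : ℕ → X) (y : ℕ → ℝ) : Prop where
  /-- The balls of a batch cover the region that is left, … -/
  cover : ∀ m, 1 ≤ m → m ≤ P.lastBatch →
    tr.region P (m - 1) ⊆ ⋃ i ∈ Set.Iio (tr.num m), tr.ball P m i
  /-- … each of them meets that region, … -/
  meets : ∀ m, 1 ≤ m → m ≤ P.lastBatch → ∀ i < tr.num m,
    (tr.ball P m i ∩ tr.region P (m - 1)).Nonempty
  /-- … and there are not more of them than the grid provides for. -/
  count : ∀ m, 1 ≤ m → m ≤ P.lastBatch → tr.num m ≤ P.ballCap m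
  /-- Each ball is queried at its centre, `P.reps m` times. -/
  query : ∀ m, 1 ≤ m → m ≤ P.lastBatch → ∀ i < tr.num m, ∀ k < P.reps m,
    x (queryTime P m i k) = tr.cen m i
  /-- The remaining steps of the batch are spent anywhere in its balls. -/
  excess : ∀ m, 1 ≤ m → m ≤ P.lastBatch → ∀ t,
    P.tau (m - 1) + tr.num m * P.reps m < t → t ≤ P.tau m →
    ∃ i < tr.num m, x t ∈ tr.ball P m i
  /-- `best m` is a ball of least average loss. -/
  best_lt : ∀ m, 1 ≤ m → m ≤ P.lastBatch → tr.best m < tr.num m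
  best_le : ∀ m, 1 ≤ m → m ≤ P.lastBatch → ∀ i < tr.num m,
    avgLoss P y m (tr.best m) ≤ avgLoss P y m i
  /-- Cleanup: one point that is not eliminated is played until the horizon. -/
  cleanup : ∃ p ∈ tr.region P P.lastBatch, ∀ t, P.tau P.lastBatch < t → t ≤ P.T → x t = p

/-- `π` is an implementation of Geometric Narrowing on the static grid: it obeys the batched
feedback protocol, and for every seed and all losses it follows the procedure, where the balls of
batch `m` are chosen from the losses up to `τ_{m-1}` and the best ball from those up to `τ_m`. -/
def IsStaticGN {U : Type*} (π : Policy X U) : Prop :=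
  RespectsGrid P π ∧
  ∃ rec : U → (ℕ → ℝ) → Transcript X,
    (∀ u y, FollowsGN P (rec u y) (fun t => π t u y) y) ∧
    (∀ u y y' m, 1 ≤ m → m ≤ P.lastBatch →
      (∀ s, 1 ≤ s → s ≤ P.tau (m - 1) → y s = y' s) →
      (rec u y).num m = (rec u y').num m ∧
      ∀ i < (rec u y).num m, (rec u y).cen m i = (rec u y').cen m i) ∧
    (∀ u y y' m, 1 ≤ m → m ≤ P.lastBatch →
      (∀ s, 1 ≤ s → s ≤ P.tau m → y s = y' s) → (rec u y).best m = (rec u y').best m)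

end

end StaticGN

end

namespace StaticGN

namespace Params

/-! Write the radius of batch `m` as `Δ * 2 ^ (-E m)`, where `E` is `batchExp`. If the noise
averages out, every point played in batch `m + 1` is within a constant multiple of `rad m` of the
minimizer. Up to constants and a factor `B ^ d`, the regret of that batch is therefore at most `log
T` times 2 to the power `(2q + d) E (m+1) - (q + d) E m`. The exponents `ĉ` are chosen so that,
before rounding, this expression is the same for all batches, namely `log₂ √(T / log T)`
(`cHat_add_cSum`). The alternation of floors and ceilings keeps the radii dyadic and costs at most
an additive `2q + d` (`batchExp_tradeoff`). So each batch contributes `O(√(T log T))` with a factor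
`A ^ d` (`batch_cost_le`).

If the grid stops because the next batch does not fit, the cleanup is no longer than that batch. If
it stops after `2 M̂` batches, `M̂` is large enough to make the last radius so small that `T` steps
cost `O(√(T log T))` (`cleanup_cost_le`). The number of batches is `O((1 + d) log log (T / log T))`,
and `1 + d` is absorbed into `A ^ d`.

The noise is controlled slot by slot. On a static grid the query times of the `i`-th ball of a batch
do not depend on the data, so a Hoeffding bound at fixed times and a union bound over all slots
suffice (`lt_measureReal_goodEvent`). On the resulting event the rest is deterministic: the
minimizer is never eliminated and the survivors cluster around it (`dist_best_le`,
`dist_le_of_mem_region`).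

That the algorithm can be run is a covering argument. The survivors lie in one ball of radius `(2 +
κ) * rad m`, and `B` pays for the extra halvings (`exists_pow_le_ballCap`,
`isStaticGN_canonicalPolicy`). -/

/-- The standing assumptions on the parameters. -/
structure Valid (P : Params) : Prop where
  lam_pos : 0 < P.lam
  lam_le : P.lam ≤ P.L
  one_le_q : 1 ≤ P.q
  diam_pos : 0 < P.diam
  d_nonneg : 0 ≤ P.d
  one_le_T : 1 ≤ P.T

/-- The logarithm of `T / log T`. -/
noncomputable def logRatio (P : Params) : ℝ := Real.log (P.T / Real.log P.T)

/-- Minus the binary logarithm of `r̄_m`. -/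
noncomputable def rrExp (P : Params) (m : ℕ) : ℤ :=
  if Even m then ⌈P.cSum (m / 2)⌉ else ⌊P.cSum ((m + 1) / 2)⌋

/-- Minus the binary logarithm of the radius used in batch `m`, in units of the diameter. -/
noncomputable def batchExp (P : Params) (m : ℕ) : ℤ := P.rrExp (P.sIdx m)

end Params

/-! ### Numerical bounds -/

/-- A lower bound for `log (T / log T)` over all `T ≥ 2`. -/
noncomputable def minLogRatio : ℝ := Real.log 2.725

lemma one_lt_minLogRatio : 1 < minLogRatio := by
  rw [minLogRatio, Real.lt_log_iff_exp_lt (by norm_num)]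
  linarith [Real.exp_one_lt_d9]

lemma log_three_le : Real.log 3 ≤ 1.1 := by
  rw [Real.log_le_iff_le_exp (by norm_num)]
  have h1 : (1.1 : ℝ) = 1 + 0.1 := by norm_num
  have h2 := Real.quadratic_le_exp_of_nonneg (x := 0.1) (by norm_num)
  rw [h1, Real.exp_add]
  nlinarith [Real.exp_one_gt_d9]

/-- The function `t / log t` has its real minimum `e` at `t = e`, but over the integers the minimum
is `3 / log 3`, which is strictly larger. The constant 2.725 lies between the two, so `log log (T /
log T)` is bounded away from 0 and can absorb additive constants. -/
lemma ratio_lower {T : ℕ} (hT : 2 ≤ T) : 2.725 ≤ (T : ℝ) / Real.log T := by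
  have h2 : (2.725 : ℝ) * Real.log 2 ≤ 2 := by linarith [Real.log_two_lt_d9]
  have hpos : 0 < Real.log T := Real.log_pos (by exact_mod_cast hT)
  rw [le_div_iff₀ hpos]
  rcases hT.eq_or_lt with rfl | hT
  · simpa using h2
  rcases (Nat.succ_le_of_lt hT).eq_or_lt with h | hT
  · rw [← h]
    have := log_three_le
    push_cast
    norm_num at *
    linarith
  · have h4 : (4 : ℝ) ≤ T := by exact_mod_cast Nat.succ_le_of_lt hT
    have he : Real.exp 1 ≤ 4 := by linarith [Real.exp_one_lt_d9]
    have := Real.log_div_self_antitoneOn (Set.mem_Ici.2 he) (Set.mem_Ici.2 (he.trans h4)) h4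
    have hl4 : Real.log 4 = 2 * Real.log 2 := by
      rw [show (4 : ℝ) = 2 ^ 2 by norm_num, Real.log_pow]; norm_num
    simp only [hl4] at this
    rw [div_le_iff₀ (by linarith)] at this
    nlinarith

namespace Params

variable {P : Params}

lemma minLogRatio_le (hT : 2 ≤ P.T) : minLogRatio ≤ P.logRatio :=
  Real.log_le_log (by norm_num) (ratio_lower hT)

lemma log_T_pos (hT : 2 ≤ P.T) : 0 < Real.log P.T := Real.log_pos (by exact_mod_cast hT)

lemma logRatio_nonneg (h : P.Valid) : 0 ≤ P.logRatio := by
  rcases h.one_le_T.eq_or_lt with h1 | h1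
  · simp [logRatio, ← h1]
  · linarith [minLogRatio_le h1, one_lt_minLogRatio]

lemma one_lt_logRatio (hT : 2 ≤ P.T) : 1 < P.logRatio :=
  one_lt_minLogRatio.trans_le (minLogRatio_le hT)

/-! ### The exponents of the radii -/

section

variable (h : P.Valid)

include h

lemma den_pos : 0 < 2 * P.q + P.d := by linarith [h.one_le_q, h.d_nonneg]

lemma eta_pos : 0 < P.eta :=
  div_pos (by linarith [h.one_le_q, h.d_nonneg]) (den_pos h)

lemma cHat_one : (2 * P.q + P.d) * P.cHat 1 = P.logRatio / (2 * Real.log 2) := by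
  have := den_pos h
  have h2 : Real.log 2 ≠ 0 := (Real.log_pos (by norm_num)).ne'
  rw [cHat, logRatio]
  field_simp

lemma cHat_nonneg (k : ℕ) : 0 ≤ P.cHat k := by
  induction k using Nat.strong_induction_on with
  | _ k ih =>
    match k with
    | 0 => simp [cHat]
    | 1 =>
      rw [cHat]
      have := den_pos h
      have h2 : 0 < Real.log 2 := Real.log_pos (by norm_num)
      have := logRatio_nonneg h
      rw [logRatio] at this
      positivity
    | k + 2 =>
      rw [cHat]
      exact mul_nonneg (eta_pos h).le (ih (k + 1) (by omega))

omit h in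
lemma cHat_succ (k : ℕ) : P.cHat (k + 1) = P.eta ^ k * P.cHat 1 := by
  induction k with
  | zero => simp
  | succ k ih =>
    have : P.cHat (k + 1 + 1) = P.eta * P.cHat (k + 1) := rfl
    rw [this, ih, pow_succ]; ring

omit h in
lemma cSum_succ (k : ℕ) : P.cSum (k + 1) = P.cSum k + P.cHat (k + 1) := by
  rw [cSum, Finset.sum_Icc_succ_top (by omega), cSum]

omit h in
@[simp] lemma cSum_zero : P.cSum 0 = 0 := by simp [cSum]

lemma cSum_le_succ (k : ℕ) : P.cSum k ≤ P.cSum (k + 1) := by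
  rw [cSum_succ]; linarith [cHat_nonneg h (k + 1)]

lemma cSum_nonneg (k : ℕ) : 0 ≤ P.cSum k :=
  Finset.sum_nonneg fun i _ => cHat_nonneg h i

lemma one_sub_eta : (2 * P.q + P.d) * (1 - P.eta) = P.q := by
  have := den_pos h
  rw [eta]; field_simp; ring

/-- A geometric sum: `ĉ` has ratio `η̂`, and `1 - η̂ = q / (2q + d)`. -/
lemma q_mul_cSum (k : ℕ) :
    P.q * P.cSum k = (1 - P.eta ^ k) * (P.logRatio / (2 * Real.log 2)) := by
  rw [← cHat_one h]
  induction k with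
  | zero => simp
  | succ k ih =>
    rw [cSum_succ, mul_add, ih, cHat_succ k, pow_succ]
    linear_combination (-P.eta ^ k * P.cHat 1) * one_sub_eta h

/-- The equalizing property of `ĉ`. With `S = cSum`, the left side is `(2q + d) S (k+1) - (q + d) S
k`, the unrounded cost exponent of a step, and it does not depend on `k`. -/
lemma cHat_add_cSum (k : ℕ) :
    (2 * P.q + P.d) * P.cHat (k + 1) + P.q * P.cSum k = P.logRatio / (2 * Real.log 2) := by
  rw [q_mul_cSum h, cHat_succ]
  linear_combination (P.eta ^ k) * cHat_one h

lemma q_mul_cSum_le (k : ℕ) : P.q * P.cSum k ≤ P.logRatio / (2 * Real.log 2) := by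
  rw [← cHat_add_cSum h k]
  have := mul_nonneg (den_pos h).le (cHat_nonneg h (k + 1))
  linarith

omit h in
lemma rr_eq (m : ℕ) : P.rr m = (2 : ℝ) ^ (-P.rrExp m) := by
  rw [rr, rrExp]; split_ifs <;> rfl

omit h in
lemma rr_le_rr {m k : ℕ} : P.rr m ≤ P.rr k ↔ P.rrExp k ≤ P.rrExp m := by
  rw [rr_eq, rr_eq, zpow_le_zpow_iff_right₀ (by norm_num)]; omega

omit h in
lemma rrExp_even (k : ℕ) : P.rrExp (2 * k) = ⌈P.cSum k⌉ := by
  rw [rrExp, if_pos (even_two_mul k)]; congr 2; omega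

omit h in
lemma rrExp_odd (k : ℕ) : P.rrExp (2 * k + 1) = ⌊P.cSum (k + 1)⌋ := by
  rw [rrExp, if_neg (by simp)]; congr 2; omega

/-- The index after an even one. -/
lemma sIdx_odd_of_even (k : ℕ) (hk : P.sIdx (2 * k) = 2 * k) :
    (⌈P.cSum k⌉ ≤ ⌊P.cSum (k + 1)⌋ → P.sIdx (2 * k + 1) = 2 * k + 1) ∧
    (⌊P.cSum (k + 1)⌋ < ⌈P.cSum k⌉ → P.sIdx (2 * k + 1) = 2 * k + 2) := by
  rcases k with _ | k
  · refine ⟨fun _ => rfl, fun hlt => ?_⟩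
    exfalso
    have := Int.floor_nonneg.2 (cSum_nonneg h 1)
    simp at hlt this
    omega
  have hs : P.sIdx (2 * (k + 1) + 1) =
      sInf {j : ℕ | 2 * (k + 1) < j ∧ P.rr j ≤ P.rr (2 * (k + 1))} := by
    have h2 : P.sIdx (2 * k + 1 + 1) = 2 * (k + 1) := hk
    rw [show 2 * (k + 1) + 1 = (2 * k + 1) + 2 by ring, sIdx, h2]
    rfl
  have hset : ∀ j, j ∈ {j : ℕ | 2 * (k + 1) < j ∧ P.rr j ≤ P.rr (2 * (k + 1))} ↔
      2 * (k + 1) < j ∧ ⌈P.cSum (k + 1)⌉ ≤ P.rrExp j := fun j => by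
    rw [Set.mem_ofPred_eq, rr_le_rr, rrExp_even]
  constructor
  · intro hle
    rw [hs]
    refine le_antisymm (Nat.sInf_le ((hset _).2 ⟨by omega, ?_⟩)) ?_
    · rwa [rrExp_odd]
    · refine le_csInf ⟨_, (hset (2 * (k + 1) + 1)).2 ⟨by omega, by rwa [rrExp_odd]⟩⟩ ?_
      intro j hj
      have := ((hset j).1 hj).1
      omega
  -- The floor would give a larger radius than the one just used, so its index is passed over. The
  -- ceiling after it qualifies because the sums increase.
  · intro hlt
    have hmem : 2 * (k + 1) < 2 * (k + 2) ∧ ⌈P.cSum (k + 1)⌉ ≤ P.rrExp (2 * (k + 2)) :=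
      ⟨by omega, by rw [rrExp_even]; exact Int.ceil_le_ceil (cSum_le_succ h _)⟩
    rw [hs]
    refine le_antisymm (Nat.sInf_le ((hset _).2 hmem)) ?_
    refine le_csInf ⟨_, (hset _).2 hmem⟩ ?_
    intro j hj
    obtain ⟨h1, h2⟩ := (hset j).1 hj
    rcases (Nat.succ_le_of_lt h1).eq_or_lt with h3 | h3
    · rw [← h3, Nat.succ_eq_add_one, rrExp_odd] at h2
      omega
    · omega

/-- The infimum runs over indices beyond `m`, not beyond `s_m`. Hence a skipped floor index does not
shift the later ones; the following ceiling radius is merely used twice. -/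
lemma sIdx_even (k : ℕ) : P.sIdx (2 * k) = 2 * k := by
  induction k with
  | zero => rfl
  | succ k ih =>
    have hodd := sIdx_odd_of_even h k ih
    have hle : P.rrExp (P.sIdx (2 * k + 1)) ≤ ⌈P.cSum (k + 1)⌉ := by
      rcases le_or_gt ⌈P.cSum k⌉ ⌊P.cSum (k + 1)⌋ with hc | hc
      · rw [hodd.1 hc, rrExp_odd]; exact Int.floor_le_ceil _
      · rw [hodd.2 hc, show 2 * k + 2 = 2 * (k + 1) by ring, rrExp_even]
    rw [show 2 * (k + 1) = (2 * k) + 2 by ring, sIdx]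
    have hmem : 2 * k + 2 ∈ {j : ℕ | 2 * k + 1 < j ∧ P.rr j ≤ P.rr (P.sIdx (2 * k + 1))} :=
      ⟨by omega, by
        rw [rr_le_rr, show 2 * k + 2 = 2 * (k + 1) by ring, rrExp_even]; exact hle⟩
    refine le_antisymm (Nat.sInf_le hmem) (le_csInf ⟨_, hmem⟩ ?_)
    intro j hj
    have := hj.1
    omega

lemma batchExp_even (k : ℕ) : P.batchExp (2 * k) = ⌈P.cSum k⌉ := by
  rw [batchExp, sIdx_even h, rrExp_even]

/-- When the floor is skipped, it lies below the previous ceiling. Then the next ceiling, at most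
one above the floor, coincides with the previous one. -/
lemma batchExp_odd (k : ℕ) :
    P.batchExp (2 * k + 1) = max ⌊P.cSum (k + 1)⌋ ⌈P.cSum k⌉ := by
  have hodd := sIdx_odd_of_even h k (sIdx_even h k)
  rw [batchExp]
  rcases le_or_gt ⌈P.cSum k⌉ ⌊P.cSum (k + 1)⌋ with hc | hc
  · rw [hodd.1 hc, rrExp_odd, max_eq_left hc]
  · rw [hodd.2 hc, show 2 * k + 2 = 2 * (k + 1) by ring, rrExp_even, max_eq_right hc.le]
    have h1 := Int.ceil_le_floor_add_one (P.cSum (k + 1))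
    have h2 := Int.ceil_le_ceil (cSum_le_succ h k)
    omega

omit h in
@[simp] lemma batchExp_zero : P.batchExp 0 = 0 := by simp [batchExp, sIdx, rrExp]

lemma batchExp_mono : Monotone P.batchExp := by
  refine monotone_nat_of_le_succ fun m => ?_
  rcases Nat.even_or_odd' m with ⟨k, rfl | rfl⟩
  · rw [batchExp_even h, batchExp_odd h]; exact le_max_right _ _
  · rw [batchExp_odd h, show 2 * k + 1 + 1 = 2 * (k + 1) by ring, batchExp_even h]
    exact max_le (Int.floor_le_ceil _) (Int.ceil_le_ceil (cSum_le_succ h k))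

/-- The trade-off between consecutive radii on which the regret of a batch rests. -/
lemma batchExp_tradeoff (m : ℕ) :
    (2 * P.q + P.d) * P.batchExp (m + 1) - (P.q + P.d) * P.batchExp m ≤
      P.logRatio / (2 * Real.log 2) + (2 * P.q + P.d) := by
  have hq := h.one_le_q
  have hd := h.d_nonneg
  rcases Nat.even_or_odd' m with ⟨k, rfl | rfl⟩
  · rw [batchExp_even h, batchExp_odd h]
    -- From a ceiling to a floor, both roundings only lower the left side, so the unrounded identity
    -- suffices. If the radius is repeated, the left side is `q * ⌈S k⌉`.
    rcases le_total ⌈P.cSum k⌉ ⌊P.cSum (k + 1)⌋ with hc | hc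
    · rw [max_eq_left hc]
      have h1 := mul_le_mul_of_nonneg_left (Int.floor_le (P.cSum (k + 1))) (den_pos h).le
      have h2 := mul_le_mul_of_nonneg_left (Int.le_ceil (P.cSum k))
        (by linarith : 0 ≤ P.q + P.d)
      have h3 := cHat_add_cSum h k
      rw [cSum_succ] at h1 ⊢
      nlinarith
    · rw [max_eq_right hc]
      have h1 := mul_le_mul_of_nonneg_left (Int.ceil_lt_add_one (P.cSum k)).le
        (by linarith : 0 ≤ P.q)
      have h2 := q_mul_cSum_le h k
      linarith
  · rw [show 2 * k + 1 + 1 = 2 * (k + 1) by ring, batchExp_even h, batchExp_odd h]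
    have h1 := mul_le_mul_of_nonneg_left (Int.ceil_lt_add_one (P.cSum (k + 1))).le
      (by linarith : 0 ≤ P.q)
    have h2 := q_mul_cSum_le h (k + 1)
    -- From a floor to its ceiling the exponent grows by at most one, which leaves `q * ⌈S⌉ + (q +
    -- d)`.
    have h3 : (⌈P.cSum (k + 1)⌉ : ℝ) - 1 ≤ ((max ⌊P.cSum (k + 1)⌋ ⌈P.cSum k⌉ : ℤ) : ℝ) := by
      have := Int.ceil_le_floor_add_one (P.cSum (k + 1))
      have h4 : ⌈P.cSum (k + 1)⌉ - 1 ≤ max ⌊P.cSum (k + 1)⌋ ⌈P.cSum k⌉ :=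
        le_max_of_le_left (by omega)
      exact_mod_cast h4
    have h4 := mul_le_mul_of_nonneg_left h3 (by linarith : 0 ≤ P.q + P.d)
    nlinarith

/-! ### Radii, repetitions, numbers of balls -/

omit h in
lemma rad_eq (m : ℕ) : P.rad m = P.diam * (2 : ℝ) ^ (-P.batchExp m) := by
  rw [rad, rr_eq, batchExp]

omit h in
@[simp] lemma rad_zero : P.rad 0 = P.diam := by simp [rad_eq]

lemma rad_pos (m : ℕ) : 0 < P.rad m := by
  have := h.diam_pos
  rw [rad_eq]; positivity

lemma rad_anti : Antitone P.rad := by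
  intro m k hmk
  rw [rad_eq, rad_eq]
  have := batchExp_mono h hmk
  have := h.diam_pos
  gcongr
  norm_num

lemma rad_le_diam (m : ℕ) : P.rad m ≤ P.diam := by
  simpa using rad_anti h (Nat.zero_le m)

lemma one_lt_kappa : 1 < P.kappa := by
  rw [kappa]
  have h1 := h.lam_pos
  have h2 := h.lam_le
  have h3 := h.one_le_q
  refine Real.one_lt_rpow ?_ (by positivity)
  rw [lt_div_iff₀ h1]; linarith

/-- The binary logarithm of `B`. -/
lemma exists_bConst : ∃ b : ℕ, 3 ≤ b ∧ P.bConst = 2 ^ b ∧ 3 + 2 * P.kappa ≤ 2 ^ b := by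
  have hk := one_lt_kappa h
  have hz : 0 < 3 + 2 * P.kappa := by linarith
  have hle : 2 < Real.logb 2 (3 + 2 * P.kappa) := by
    rw [Real.lt_logb_iff_rpow_lt (by norm_num) hz]; norm_num; linarith
  have h3 : 2 < ⌈Real.logb 2 (3 + 2 * P.kappa)⌉ := by
    rw [Int.lt_ceil]; exact_mod_cast hle
  obtain ⟨b, hb⟩ := Int.eq_ofNat_of_zero_le (by omega : 0 ≤ ⌈Real.logb 2 (3 + 2 * P.kappa)⌉)
  refine ⟨b, by omega, by rw [bConst, ceilTwo, hb]; simp, ?_⟩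
  have h4 := Int.le_ceil (Real.logb 2 (3 + 2 * P.kappa))
  rw [hb, Real.logb_le_iff_le_rpow (by norm_num) hz] at h4
  simpa using h4

lemma one_le_bConst : 1 ≤ P.bConst := by
  obtain ⟨b, -, hb, -⟩ := exists_bConst h
  rw [hb]; exact one_le_pow₀ (by norm_num)

omit h in
/-- The ratio of consecutive radii. -/
lemma rr_ratio (m : ℕ) :
    P.rr (P.sIdx m) / P.rr (P.sIdx (m + 1)) =
      (2 : ℝ) ^ (P.batchExp (m + 1) - P.batchExp m) := by
  rw [rr_eq, rr_eq, ← batchExp, ← batchExp, ← zpow_sub₀ (by norm_num)]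
  congr 1; ring

lemma ballCap_pos (m : ℕ) : 0 < P.ballCap (m + 1) := by
  have := one_le_bConst h
  rcases m with _ | m
  · rw [ballCap, Nat.ceil_pos, rr_eq]; positivity
  · rw [ballCap, Nat.ceil_pos, rr_ratio]; positivity

lemma ballCap_le (m : ℕ) : (P.ballCap (m + 1) : ℝ) ≤
    2 * (((2 : ℝ) ^ (P.batchExp (m + 1) - P.batchExp m)) ^ P.d * P.bConst ^ P.d) := by
  have hB := one_le_bConst h
  have hd := h.d_nonneg
  have hr : (1 : ℝ) ≤ (2 : ℝ) ^ (P.batchExp (m + 1) - P.batchExp m) :=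
    one_le_zpow₀ (by norm_num) (by have := batchExp_mono h (Nat.le_add_right m 1); omega)
  have h1 : (1 : ℝ) ≤ ((2 : ℝ) ^ (P.batchExp (m + 1) - P.batchExp m)) ^ P.d * P.bConst ^ P.d :=
    one_le_mul_of_one_le_of_one_le (Real.one_le_rpow hr hd) (Real.one_le_rpow hB hd)
  have key : (P.ballCap (m + 1) : ℝ) ≤
      ⌈((2 : ℝ) ^ (P.batchExp (m + 1) - P.batchExp m)) ^ P.d * P.bConst ^ P.d⌉₊ := by
    rcases m with _ | m
    · rw [ballCap]
      -- Discarding the factor 1/2 of `b₁` and using exponent 0 for the initial radius makes the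
      -- first batch an instance of the general formula.
      have : 1 / (2 * P.rr (P.sIdx 1)) ≤ (2 : ℝ) ^ (P.batchExp (0 + 1) - P.batchExp 0) := by
        rw [rr_eq, ← batchExp, batchExp_zero, sub_zero, zpow_neg]
        have : (0 : ℝ) < 2 ^ P.batchExp 1 := by positivity
        rw [zero_add]
        field_simp
        norm_num
      have h0 : 0 ≤ 1 / (2 * P.rr (P.sIdx 1)) := by rw [rr_eq]; positivity
      gcongr
    · rw [ballCap, rr_ratio]
  have h2 := Nat.ceil_lt_add_one (zero_le_one.trans h1)
  linarith

lemma reps_pos (hT : 2 ≤ P.T) (m : ℕ) : 0 < P.reps m := by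
  rw [reps, Nat.ceil_pos]
  have := log_T_pos hT
  have := rad_pos h m
  have := h.lam_pos
  positivity

lemma reps_le (hT : 2 ≤ P.T) (m : ℕ) : (P.reps m : ℝ) ≤
    (16 / P.lam ^ 2 + P.diam ^ (2 * P.q) / Real.log 2) * Real.log P.T / P.rad m ^ (2 * P.q) := by
  have hl := log_T_pos hT
  have hr := rad_pos h m
  have hlam := h.lam_pos
  have hq := h.one_le_q
  have h2 : 0 < Real.log 2 := Real.log_pos (by norm_num)
  have h1 := Nat.ceil_lt_add_one (a := 16 * Real.log P.T / (P.lam ^ 2 * P.rad m ^ (2 * P.q)))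
    (by positivity)
  have h3 : P.rad m ^ (2 * P.q) ≤ P.diam ^ (2 * P.q) :=
    Real.rpow_le_rpow hr.le (rad_le_diam h m) (by linarith)
  have h4 : Real.log 2 ≤ Real.log P.T := Real.log_le_log (by norm_num) (by exact_mod_cast hT)
  have hp : 0 < P.rad m ^ (2 * P.q) := by positivity
  have hp' : 0 < P.diam ^ (2 * P.q) := hp.trans_le h3
  -- This absorbs the `+ 1` of the ceiling, since `rad m ≤ diam` and `log 2 ≤ log T`.
  have h5 : 1 ≤ P.diam ^ (2 * P.q) / Real.log 2 * Real.log P.T / P.rad m ^ (2 * P.q) := by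
    rw [le_div_iff₀ hp, one_mul, div_mul_eq_mul_div, le_div_iff₀ h2]
    gcongr
  rw [reps]
  refine h1.le.trans ?_
  have : (16 / P.lam ^ 2 + P.diam ^ (2 * P.q) / Real.log 2) * Real.log P.T / P.rad m ^ (2 * P.q)
      = 16 * Real.log P.T / (P.lam ^ 2 * P.rad m ^ (2 * P.q)) +
        P.diam ^ (2 * P.q) / Real.log 2 * Real.log P.T / P.rad m ^ (2 * P.q) := by
    field_simp
  rw [this]
  linarith

/-! ### The grid -/

omit h in
lemma tau_mono : Monotone P.tau :=
  monotone_nat_of_le_succ fun m => by rw [tau]; omega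

lemma tau_strictMono (hT : 2 ≤ P.T) : StrictMono P.tau := by
  refine strictMono_nat_of_lt_succ fun m => ?_
  rw [tau]
  have := Nat.mul_pos (ballCap_pos h m) (reps_pos h hT (m + 1))
  omega

omit h in
lemma tau_lastBatch_le : P.tau P.lastBatch ≤ P.T :=
  Nat.findGreatest_spec (P := fun m => P.tau m ≤ P.T) (Nat.zero_le _) (Nat.zero_le _)

omit h in
lemma lastBatch_le : P.lastBatch ≤ 2 * P.mHat := Nat.findGreatest_le _

omit h in
lemma lt_tau_of_lastBatch_lt (hM : P.lastBatch < 2 * P.mHat) :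
    P.T < P.tau (P.lastBatch + 1) := by
  have := Nat.findGreatest_is_greatest (P := fun m => P.tau m ≤ P.T)
    (Nat.lt_succ_self P.lastBatch) hM
  simpa using this

omit h in
lemma mHat_eq_zero (hT : P.T = 1) : P.mHat = 0 := by simp [mHat, hT]

lemma strictMonoOn_tau : StrictMonoOn P.tau (Set.Iic P.lastBatch) := by
  rcases h.one_le_T.eq_or_lt with h1 | h1
  · have h0 : P.lastBatch = 0 := by
      have := lastBatch_le (P := P)
      rw [mHat_eq_zero h1.symm] at this
      omega
    intro a ha b hb hab
    rw [Set.mem_Iic, h0] at ha hb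
    omega
  · exact (tau_strictMono h h1).strictMonoOn _

/-- Since `q ≥ 1`, `1 / η̂ = 1 + q / (q + d) ≥ 1 + 1 / (1 + d)`, and Bernoulli's inequality bounds
this below by `2 ^ (1 / (1 + d))`. This is where the number of batches acquires its factor `1 + d`.
-/
lemma log_inv_eta : Real.log 2 / (1 + P.d) ≤ Real.log (1 / P.eta) := by
  have hq := h.one_le_q
  have hd := h.d_nonneg
  have h2 : 0 < Real.log 2 := Real.log_pos (by norm_num)
  have hx : 1 / (1 + P.d) ≤ 1 := by rw [div_le_one (by linarith)]; linarith
  have key : 1 + 1 / (1 + P.d) ≤ 1 / P.eta := by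
    rw [eta, one_div_div, ← sub_nonneg]
    have : (2 * P.q + P.d) / (P.q + P.d) - (1 + 1 / (1 + P.d)) =
        (P.q - 1) * P.d / ((P.q + P.d) * (1 + P.d)) := by
      have : P.q + P.d ≠ 0 := by positivity
      have : 1 + P.d ≠ 0 := by positivity
      field_simp
      ring
    rw [this]
    have : 0 ≤ P.q - 1 := by linarith
    positivity
  have h3 : (2 : ℝ) ^ (1 / (1 + P.d)) ≤ 1 + 1 / (1 + P.d) := by
    have := rpow_one_add_le_one_add_mul_self (s := 1) (by norm_num)
      (p := 1 / (1 + P.d)) (by positivity) hx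
    norm_num at this ⊢
    exact this
  calc Real.log 2 / (1 + P.d) = Real.log ((2 : ℝ) ^ (1 / (1 + P.d))) := by
        rw [Real.log_rpow (by norm_num)]; ring
    _ ≤ _ := Real.log_le_log (by positivity) (h3.trans key)

lemma mHat_le (hT : 2 ≤ P.T) :
    (P.mHat : ℝ) ≤ (1 + P.d) / Real.log 2 * Real.log P.logRatio + 1 := by
  have h2 : 0 < Real.log 2 := Real.log_pos (by norm_num)
  have hd := h.d_nonneg
  have hl := Real.log_pos (one_lt_logRatio hT)
  have h1 := log_inv_eta h
  have h3 : 0 < Real.log 2 / (1 + P.d) := by positivity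
  have h4 := Nat.ceil_lt_add_one
    (a := Real.log (Real.log (P.T / Real.log P.T)) / Real.log (1 / P.eta))
    (div_nonneg hl.le (h3.le.trans h1))
  rw [mHat]
  refine h4.le.trans ?_
  have : Real.log (Real.log (P.T / Real.log P.T)) / Real.log (1 / P.eta) ≤
      Real.log P.logRatio / (Real.log 2 / (1 + P.d)) :=
    div_le_div_of_nonneg_left hl.le h3 h1
  have h5 : Real.log P.logRatio / (Real.log 2 / (1 + P.d)) =
    (1 + P.d) / Real.log 2 * Real.log P.logRatio := by field_simp
  linarith

/-- The reason for the choice of `M̂`: after that many terms, the sum of the `ĉ` is within a bounded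
distance of its limit. -/
lemma eta_pow_mHat (hT : 2 ≤ P.T) : P.eta ^ P.mHat * P.logRatio ≤ 1 := by
  have h0 := eta_pos h
  have hl := one_lt_logRatio hT
  have h2 : 0 < Real.log 2 := Real.log_pos (by norm_num)
  have hd := h.d_nonneg
  have h3 : 0 < Real.log 2 / (1 + P.d) := by positivity
  have h1 := h3.trans_le (log_inv_eta h)
  have h4 := Nat.le_ceil (Real.log (Real.log (P.T / Real.log P.T)) / Real.log (1 / P.eta))
  rw [← mHat, div_le_iff₀ h1, one_div, Real.log_inv] at h4
  rw [← Real.log_nonpos_iff (by positivity), Real.log_mul (by positivity) (by positivity),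
    Real.log_pow, logRatio]
  linarith

end

end Params

/-! ### Covers in doubling spaces -/

section Doubling

variable {X : Type*} [MetricSpace X]

lemma HasDoublingBound.exists_cover {N : ℕ} (hN : HasDoublingBound X N) (k : ℕ) (x : X) {r : ℝ}
    (hr : 0 < r) : ∃ s : Finset X, s.card ≤ N ^ k ∧
      Metric.closedBall x r ⊆ ⋃ z ∈ s, Metric.closedBall z (r / 2 ^ k) := by
  classical
  induction k with
  | zero => exact ⟨{x}, by simp, by simp⟩
  | succ k ih =>
    obtain ⟨s, hs, hcov⟩ := ih
    choose g hg using fun z : X => hN z (r / 2 ^ k) (by positivity)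
    refine ⟨s.biUnion g, ?_, fun w hw => ?_⟩
    · calc (s.biUnion g).card ≤ s.card * N := Finset.card_biUnion_le_card_mul _ _ _
            fun z _ => (hg z).1
        _ ≤ N ^ k * N := Nat.mul_le_mul_right _ hs
        _ = N ^ (k + 1) := (pow_succ _ _).symm
    · obtain ⟨z, hz, hwz⟩ := Set.mem_iUnion₂.1 (hcov hw)
      obtain ⟨v, hv, hwv⟩ := Set.mem_iUnion₂.1 ((hg z).2 hwz)
      refine Set.mem_iUnion₂.2 ⟨v, Finset.mem_biUnion.2 ⟨z, hz, hv⟩, ?_⟩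
      rwa [pow_succ, ← div_div]

lemma IsDoubling.hasDoublingBound (h : IsDoubling X) :
    HasDoublingBound X (doublingConstant X) := Nat.sInf_mem h

lemma IsDoubling.doublingConstant_pos [Nonempty X] (h : IsDoubling X) :
    0 < doublingConstant X := by
  rw [Nat.pos_iff_ne_zero]
  intro h0
  obtain ⟨x⟩ := ‹Nonempty X›
  obtain ⟨s, hs, hcov⟩ := h.hasDoublingBound x 1 one_pos
  rw [h0, Nat.le_zero, Finset.card_eq_zero] at hs
  subst hs
  simpa using hcov (Metric.mem_closedBall_self zero_le_one)

lemma IsDoubling.doublingDim_nonneg [Nonempty X] (h : IsDoubling X) : 0 ≤ doublingDim X :=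
  Real.logb_nonneg (by norm_num) (by exact_mod_cast h.doublingConstant_pos)

lemma IsDoubling.two_rpow_doublingDim [Nonempty X] (h : IsDoubling X) :
    (2 : ℝ) ^ doublingDim X = doublingConstant X :=
  Real.rpow_logb (by norm_num) (by norm_num) (by exact_mod_cast h.doublingConstant_pos)

end Doubling

namespace Params

variable {P : Params}

/-- Enough balls are provided for in a batch to halve radii sufficiently often. -/
lemma exists_pow_le_ballCap (h : P.Valid) (m : ℕ) : ∃ j : ℕ,
    ((2 : ℝ) ^ P.d) ^ j ≤ P.ballCap (m + 1) ∧ P.rad m ≤ 2 ^ j * P.rad (m + 1) ∧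
      (0 < m → (2 + P.kappa) * P.rad m ≤ 2 ^ j * P.rad (m + 1)) := by
  obtain ⟨b, hb3, hb, hbk⟩ := exists_bConst h
  obtain ⟨e, he⟩ := Int.eq_ofNat_of_zero_le
    (by have := batchExp_mono h (Nat.le_add_right m 1); omega :
      0 ≤ P.batchExp (m + 1) - P.batchExp m)
  have hcomm : ∀ k : ℕ, ((2 : ℝ) ^ k) ^ P.d = ((2 : ℝ) ^ P.d) ^ k := fun k => by
    rw [← Real.rpow_natCast, ← Real.rpow_mul (by norm_num), mul_comm, Real.rpow_mul (by norm_num),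
      Real.rpow_natCast]
  have hrad : P.rad m = 2 ^ e * P.rad (m + 1) := by
    rw [rad_eq, rad_eq, ← zpow_natCast, show (e : ℤ) = P.batchExp (m + 1) - P.batchExp m from he.symm,
      mul_left_comm, ← zpow_add₀ (by norm_num)]
    congr 2; ring
  have hpos := rad_pos h (m + 1)
  have hk := one_lt_kappa h
  rcases m with _ | m
  -- The factor 1/2 in `b₁` costs one halving. It can be spared, because the whole space already
  -- lies in a ball of radius `diam`, without the factor `2 + κ`.
  · refine ⟨e + (b - 1), ?_, ?_, fun h0 => absurd h0 (lt_irrefl _)⟩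
    · rw [ballCap]
      refine le_trans (le_of_eq ?_) (Nat.le_ceil _)
      have h1 : 1 / (2 * P.rr (P.sIdx 1)) * P.bConst = (2 : ℝ) ^ (e + (b - 1)) := by
        rw [rr_eq, ← batchExp, show P.batchExp 1 = e by simpa using he, hb]
        obtain ⟨c, rfl⟩ : ∃ c, b = c + 1 := ⟨b - 1, by omega⟩
        simp only [zpow_neg, zpow_natCast, Nat.add_sub_cancel, pow_add]
        field_simp
      rw [← Real.mul_rpow (by rw [rr_eq]; positivity) (by rw [hb]; positivity), h1, hcomm]
    · rw [hrad]
      gcongr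
      · norm_num
      · omega
  -- Of these halvings, `e` bridge the two radii and `b` remove the factor `2 + κ ≤ 2 ^ b`.
  · refine ⟨e + b, ?_, ?_, fun _ => ?_⟩
    · rw [ballCap]
      refine le_trans (le_of_eq ?_) (Nat.le_ceil _)
      rw [rr_ratio, he, hb, zpow_natCast, hcomm, hcomm, pow_add]
    · rw [hrad]
      gcongr
      · norm_num
      · omega
    · rw [hrad, pow_add, mul_right_comm, mul_comm]
      have h1 : 2 + P.kappa ≤ 2 ^ b := by linarith
      have h2 := mul_le_mul_of_nonneg_left h1 (by positivity : 0 ≤ 2 ^ e * P.rad (m + 1 + 1))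
      linarith

end Params

/-! ### An implementation of the algorithm on the grid -/

section Run

variable {X : Type*} [MetricSpace X] (P : Params)

/-- The balls of batch `m` with the first `c.1` of the centres `c.2` cover `S`, meet it, and respect
the number provided for. -/
def IsCover (m : ℕ) (S : Set X) (c : ℕ × (ℕ → X)) : Prop :=
  S ⊆ ⋃ i ∈ Set.Iio c.1, Metric.closedBall (c.2 i) (P.rad m) ∧
  (∀ i < c.1, (Metric.closedBall (c.2 i) (P.rad m) ∩ S).Nonempty) ∧ c.1 ≤ P.ballCap m

lemma exists_isCover_of_finset [Nonempty X] {m : ℕ} {S : Set X} (s : Finset X)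
    (hs : s.card ≤ P.ballCap m) (hcov : S ⊆ ⋃ z ∈ s, Metric.closedBall z (P.rad m)) :
    ∃ c, IsCover P m S c := by
  classical
  obtain ⟨x0⟩ := ‹Nonempty X›
  let s' := s.filter fun z => (Metric.closedBall z (P.rad m) ∩ S).Nonempty
  let cen : ℕ → X := fun i => if hi : i < s'.card then (s'.equivFin.symm ⟨i, hi⟩ : X) else x0
  refine ⟨(s'.card, cen), fun x hx => ?_, fun i hi => ?_, (Finset.card_filter_le _ _).trans hs⟩
  · obtain ⟨z, hz, hxz⟩ := Set.mem_iUnion₂.1 (hcov hx)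
    have hz' : z ∈ s' := Finset.mem_filter.2 ⟨hz, x, hxz, hx⟩
    refine Set.mem_iUnion₂.2 ⟨s'.equivFin ⟨z, hz'⟩, (s'.equivFin ⟨z, hz'⟩).2, ?_⟩
    simpa [cen] using hxz
  · have hi' : i < s'.card := hi
    have := (Finset.mem_filter.1 (s'.equivFin.symm ⟨i, hi'⟩).2).2
    simpa [cen, hi'] using this

lemma exists_isCover [Nonempty X] {P : Params} (h : P.Valid) (hX : IsDoubling X)
    (hd : P.d = doublingDim X) {m : ℕ} {S : Set X} {c : X} {R : ℝ} (hR : 0 < R)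
    (hS : S ⊆ Metric.closedBall c R)
    (hRm : R ≤ P.rad m ∨ 0 < m ∧ R ≤ (2 + P.kappa) * P.rad m) :
    ∃ c, IsCover P (m + 1) S c := by
  obtain ⟨j, hj, h1, h2⟩ := Params.exists_pow_le_ballCap h m
  obtain ⟨s, hs, hcov⟩ := hX.hasDoublingBound.exists_cover j c hR
  rw [hd, hX.two_rpow_doublingDim] at hj
  refine exists_isCover_of_finset P s (hs.trans (by exact_mod_cast hj)) ?_
  refine hS.trans (hcov.trans (Set.iUnion₂_mono fun z _ => Metric.closedBall_subset_closedBall ?_))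
  rw [div_le_iff₀' (by positivity)]
  rcases hRm with h3 | ⟨h0, h3⟩
  · exact h3.trans h1
  · exact h3.trans (h2 h0)

open Classical in
/-- A chosen cover of `S` by balls of batch `m`. -/
noncomputable def chosenCover [Nonempty X] (m : ℕ) (S : Set X) : ℕ × (ℕ → X) :=
  if h : ∃ c, IsCover P m S c then h.choose else (0, fun _ => Classical.arbitrary X)

lemma isCover_chosenCover [Nonempty X] {m : ℕ} {S : Set X} (h : ∃ c, IsCover P m S c) :
    IsCover P m S (chosenCover P m S) := by
  rw [chosenCover, dif_pos h]; exact h.choose_spec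

lemma chosenCover_le [Nonempty X] (m : ℕ) (S : Set X) :
    (chosenCover P m S).1 ≤ P.ballCap m := by
  by_cases h : ∃ c, IsCover P m S c
  · exact (isCover_chosenCover P h).2.2
  · rw [chosenCover, dif_neg h]; exact Nat.zero_le _

/-- The first ball of least average loss in batch `m` among the first `n`. -/
noncomputable def firstBest (y : ℕ → ℝ) (m n : ℕ) : ℕ :=
  sInf {b | b < n ∧ ∀ i < n, avgLoss P y m b ≤ avgLoss P y m i}

lemma firstBest_spec (y : ℕ → ℝ) (m : ℕ) {n : ℕ} (hn : 0 < n) :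
    firstBest P y m n < n ∧
      ∀ i < n, avgLoss P y m (firstBest P y m n) ≤ avgLoss P y m i := by
  obtain ⟨b, hb, hmin⟩ := Finset.exists_min_image (Finset.range n) (avgLoss P y m) ⟨0, by simpa⟩
  exact Nat.sInf_mem (s := {b | b < n ∧ ∀ i < n, avgLoss P y m b ≤ avgLoss P y m i})
    ⟨b, by simpa using hb, fun i hi => hmin i (by simpa using hi)⟩

lemma queryTime_le_tau {m i k : ℕ} (hi : i < P.ballCap (m + 1)) (hk : k < P.reps (m + 1)) :
    queryTime P (m + 1) i k ≤ P.tau (m + 1) := by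
  rw [queryTime, Params.tau, Nat.add_sub_cancel]
  have : (i + 1) * P.reps (m + 1) ≤ P.ballCap (m + 1) * P.reps (m + 1) :=
    Nat.mul_le_mul_right _ hi
  rw [add_mul, one_mul] at this
  omega

lemma avgLoss_congr {y y' : ℕ → ℝ} {m i : ℕ} (hi : i < P.ballCap (m + 1))
    (hy : ∀ s, 1 ≤ s → s ≤ P.tau (m + 1) → y s = y' s) :
    avgLoss P y (m + 1) i = avgLoss P y' (m + 1) i := by
  rw [avgLoss, avgLoss]
  congr 1
  refine Finset.sum_congr rfl fun k hk => hy _ ?_ ?_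
  · rw [queryTime]; omega
  · exact queryTime_le_tau P hi (Finset.mem_range.1 hk)

lemma firstBest_congr {y y' : ℕ → ℝ} {m n : ℕ} (hn : n ≤ P.ballCap (m + 1))
    (hy : ∀ s, 1 ≤ s → s ≤ P.tau (m + 1) → y s = y' s) :
    firstBest P y (m + 1) n = firstBest P y' (m + 1) n := by
  rw [firstBest, firstBest]
  congr 1
  ext b
  refine and_congr_right fun hb => forall₂_congr fun i hi => ?_
  rw [avgLoss_congr P (hb.trans_le hn) hy, avgLoss_congr P (hi.trans_le hn) hy]

variable [Nonempty X]

/-- The region left after batch `m` when covers and best balls are chosen canonically. -/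
noncomputable def runRegion (y : ℕ → ℝ) : ℕ → Set X
  | 0 => Set.univ
  | (m + 1) =>
    let c := chosenCover P (m + 1) (runRegion y m)
    ⋃ i ∈ {i | i < c.1 ∧ ∀ x ∈ Metric.closedBall (c.2 i) (P.rad (m + 1)),
      dist x (c.2 (firstBest P y (m + 1) c.1)) ≤ (2 + P.kappa) * P.rad (m + 1)},
      Metric.closedBall (c.2 i) (P.rad (m + 1))

/-- The canonical run on the losses `y`. -/
noncomputable def run (y : ℕ → ℝ) : Transcript X where
  num m := (chosenCover P m (runRegion (X := X) P y (m - 1))).1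
  cen m := (chosenCover P m (runRegion (X := X) P y (m - 1))).2
  best m := firstBest P y m (chosenCover P m (runRegion (X := X) P y (m - 1))).1

lemma region_run (y : ℕ → ℝ) (m : ℕ) :
    (run (X := X) P y).region P m = runRegion P y m := by
  cases m <;> rfl

/-- The chosen cover is a function of the region alone, so the losses enter only through the best
balls, whose averages use losses up to `tau m`. -/
lemma runRegion_congr {y y' : ℕ → ℝ} {m : ℕ} (hy : ∀ s, 1 ≤ s → s ≤ P.tau m → y s = y' s) :
    runRegion (X := X) P y m = runRegion P y' m := by
  induction m with
  | zero => rfl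
  | succ m ih =>
    have hm : runRegion (X := X) P y m = runRegion P y' m :=
      ih fun s h1 h2 => hy s h1 (h2.trans (Params.tau_mono (Nat.le_add_right m 1)))
    simp only [runRegion, hm, firstBest_congr P (chosenCover_le P (m + 1) _) hy]

lemma run_congr {y y' : ℕ → ℝ} {m : ℕ} (hy : ∀ s, 1 ≤ s → s ≤ P.tau m → y s = y' s) :
    (run (X := X) P y).num (m + 1) = (run (X := X) P y').num (m + 1) ∧
      (run (X := X) P y).cen (m + 1) = (run P y').cen (m + 1) := by
  simp only [run, Nat.add_sub_cancel, runRegion_congr P hy, and_self]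

lemma run_best_congr {y y' : ℕ → ℝ} {m : ℕ} (hy : ∀ s, 1 ≤ s → s ≤ P.tau m → y s = y' s) :
    (run (X := X) P y).best m = (run (X := X) P y').best m := by
  rcases m with _ | m
  -- There is no batch 0: its `ballCap` is 0, so the best index is the infimum of an empty set on
  -- both sides.
  · simp only [run, runRegion, firstBest,
      Nat.le_zero.1 (chosenCover_le P 0 (Set.univ : Set X)), Nat.zero_sub]
    simp
  · have hm : runRegion (X := X) P y m = runRegion P y' m :=
      runRegion_congr P fun s h1 h2 => hy s h1 (h2.trans (Params.tau_mono (Nat.le_add_right m 1)))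
    simp only [run, Nat.add_sub_cancel, hm]
    exact firstBest_congr P (chosenCover_le P _ _) hy

open Classical in
/-- Geometric Narrowing with canonical choices. -/
noncomputable def canonicalPolicy (U : Type*) : Policy X U := fun t _ y =>
  let m := Nat.findGreatest (fun m => P.tau m < t) P.lastBatch
  if m < P.lastBatch then
    let i := (t - P.tau m - 1) / P.reps (m + 1)
    (run P y).cen (m + 1) (if i < (run (X := X) P y).num (m + 1) then i else 0)
  else if P.lastBatch = 0 then Classical.arbitrary X
  else (run P y).cen P.lastBatch ((run (X := X) P y).best P.lastBatch)

lemma respectsGrid_canonicalPolicy (U : Type*) :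
    RespectsGrid P (canonicalPolicy (X := X) P U) := by
  intro t u y y' _ hy
  rw [Params.lastComm] at hy
  simp only [canonicalPolicy]
  set m := Nat.findGreatest (fun m => P.tau m < t) P.lastBatch
  obtain ⟨h1, h2⟩ := run_congr (X := X) P hy
  simp only [h1, h2]
  split_ifs with hm _ h0
  · rfl
  · rfl
  · rfl
  -- In the cleanup phase, the last centres depend on the losses up to the last grid point but one,
  -- the best index on those up to the last.
  · have hlast : m = P.lastBatch := le_antisymm (Nat.findGreatest_le _) (not_lt.1 hm)
    rw [hlast] at hy
    obtain ⟨k, hk⟩ := Nat.exists_eq_succ_of_ne_zero h0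
    have := (run_congr (X := X) P (m := k) (y := y) (y' := y') fun s a b => hy s a
      (b.trans (Params.tau_mono (by omega)))).2
    rw [run_best_congr P hy]
    conv_lhs => rw [hk]
    conv_rhs => rw [hk]
    rw [Nat.succ_eq_add_one, this]

omit [Nonempty X] in
lemma findGreatest_tau {m t : ℕ} (hm : m ≤ P.lastBatch) (h1 : P.tau m < t)
    (h2 : m < P.lastBatch → t ≤ P.tau (m + 1)) :
    Nat.findGreatest (fun m => P.tau m < t) P.lastBatch = m := by
  rw [Nat.findGreatest_eq_iff]
  refine ⟨hm, fun _ => h1, fun k hk hk2 => not_lt.2 ?_⟩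
  exact (h2 (hk.trans_le hk2)).trans (Params.tau_mono hk)

/-! ### The canonical run obeys the procedure -/

section Spec

variable {P} (h : P.Valid) (hX : IsDoubling X) (hd : P.d = doublingDim X)
  (hdiam : ∀ x y : X, dist x y ≤ P.diam)

include h hX hd hdiam

lemma isCover_run (y : ℕ → ℝ) (m : ℕ) :
    IsCover P (m + 1) (runRegion (X := X) P y m) (chosenCover P (m + 1) (runRegion P y m)) := by
  refine isCover_chosenCover P ?_
  have hk := Params.one_lt_kappa h
  rcases m with _ | m
  · refine exists_isCover h hX hd (c := Classical.arbitrary X) h.diam_pos (fun x _ => hdiam _ _)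
      (Or.inl ?_)
    simp
  · have := Params.rad_pos h (m + 1)
    refine exists_isCover h hX hd (c := (run P y).cen (m + 1) ((run (X := X) P y).best (m + 1)))
      (R := (2 + P.kappa) * P.rad (m + 1)) (by positivity)
      ?_ (Or.inr ⟨by omega, le_rfl⟩)
    intro x hx
    obtain ⟨i, hi, hxi⟩ := Set.mem_iUnion₂.1 hx
    exact hi.2 x hxi

/-- Whatever the losses, the best ball survives its own test, because its radius is below `(2 + κ) *
rad`. Hence the region never becomes empty. -/
lemma num_pos_and_best_mem (y : ℕ → ℝ) (m : ℕ) :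
    (runRegion (X := X) P y m).Nonempty ∧ 0 < (run (X := X) P y).num (m + 1) ∧
      (run (X := X) P y).cen (m + 1) ((run (X := X) P y).best (m + 1)) ∈
        runRegion P y (m + 1) := by
  have key : ∀ m, (runRegion (X := X) P y m).Nonempty →
      0 < (run (X := X) P y).num (m + 1) ∧
      (run (X := X) P y).cen (m + 1) ((run (X := X) P y).best (m + 1)) ∈
        runRegion P y (m + 1) := by
    intro m hne
    have hpos : 0 < (run (X := X) P y).num (m + 1) := by
      obtain ⟨x, hx⟩ := hne
      obtain ⟨i, hi, -⟩ := Set.mem_iUnion₂.1 ((isCover_run h hX hd hdiam y m).1 hx)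
      exact (Nat.zero_le _).trans_lt hi
    refine ⟨hpos, ?_⟩
    have hr := Params.rad_pos h (m + 1)
    have hk := Params.one_lt_kappa h
    refine Set.mem_iUnion₂.2 ⟨(run (X := X) P y).best (m + 1),
      ⟨(firstBest_spec P y (m + 1) hpos).1, fun x hx => ?_⟩, Metric.mem_closedBall_self hr.le⟩
    refine (Metric.mem_closedBall.1 hx).trans ?_
    nlinarith
  have hne : (runRegion (X := X) P y m).Nonempty := by
    induction m with
    | zero => exact Set.univ_nonempty
    | succ m ih => exact ⟨_, (key m ih).2⟩
  exact ⟨hne, key m hne⟩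

lemma followsGN_run (U : Type*) (u : U) (y : ℕ → ℝ) :
    FollowsGN P (run P y) (fun t => canonicalPolicy (X := X) P U t u y) y where
  cover m h1 _ := by
    obtain ⟨m, rfl⟩ := Nat.exists_eq_succ_of_ne_zero (by omega : m ≠ 0)
    rw [region_run]
    exact (isCover_run h hX hd hdiam y m).1
  meets m h1 _ := by
    obtain ⟨m, rfl⟩ := Nat.exists_eq_succ_of_ne_zero (by omega : m ≠ 0)
    rw [region_run]
    exact (isCover_run h hX hd hdiam y m).2.1
  count m _ _ := chosenCover_le P _ _
  query m h1 hm i hi k hk := by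
    obtain ⟨m, rfl⟩ := Nat.exists_eq_succ_of_ne_zero (by omega : m ≠ 0)
    have hle := queryTime_le_tau P (hi.trans_le (chosenCover_le P _ _)) hk
    have hf := findGreatest_tau P (m := m) (t := queryTime P (m + 1) i k) (by omega)
      (by rw [queryTime, Nat.add_sub_cancel]; omega) (fun _ => hle)
    have hi2 : (queryTime P (m + 1) i k - P.tau m - 1) / P.reps (m + 1) = i := by
      rw [queryTime, Nat.add_sub_cancel,
        show P.tau m + i * P.reps (m + 1) + k + 1 - P.tau m - 1 = k + i * P.reps (m + 1) by omega,
        Nat.add_mul_div_right _ _ (by have := hk; simp at this; omega), Nat.div_eq_of_lt hk,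
        zero_add]
    simp only [canonicalPolicy, hf, Nat.succ_eq_add_one, hi2]
    rw [if_pos (by omega), if_pos hi]
  excess m h1 hm t ht1 ht2 := by
    obtain ⟨m, rfl⟩ := Nat.exists_eq_succ_of_ne_zero (by omega : m ≠ 0)
    rw [Nat.succ_eq_add_one, Nat.add_sub_cancel] at ht1
    have hf := findGreatest_tau P (m := m) (t := t) (by omega) (by omega) (fun _ => ht2)
    -- Surplus steps decode to an index past the last ball and fall back to ball 0, which therefore
    -- has to exist.
    have hnum := (num_pos_and_best_mem h hX hd hdiam y m).2.1
    simp only [canonicalPolicy, hf]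
    rw [if_pos (by omega)]
    refine ⟨_, ?_, Metric.mem_closedBall_self (Params.rad_pos h _).le⟩
    rw [Nat.succ_eq_add_one]
    split_ifs with hc
    · exact hc
    · exact hnum
  best_lt m h1 _ := by
    obtain ⟨m, rfl⟩ := Nat.exists_eq_succ_of_ne_zero (by omega : m ≠ 0)
    exact (firstBest_spec P y _ (num_pos_and_best_mem h hX hd hdiam y m).2.1).1
  best_le m h1 _ := by
    obtain ⟨m, rfl⟩ := Nat.exists_eq_succ_of_ne_zero (by omega : m ≠ 0)
    exact (firstBest_spec P y _ (num_pos_and_best_mem h hX hd hdiam y m).2.1).2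
  cleanup := by
    have hf : ∀ t, P.tau P.lastBatch < t →
        Nat.findGreatest (fun m => P.tau m < t) P.lastBatch = P.lastBatch := fun t ht =>
      findGreatest_tau P le_rfl ht fun hlt => absurd hlt (lt_irrefl _)
    rw [region_run]
    rcases Nat.eq_zero_or_pos P.lastBatch with h0 | hpos
    · refine ⟨Classical.arbitrary X, by rw [h0]; trivial, fun t ht _ => ?_⟩
      simp only [canonicalPolicy, hf t ht]
      rw [if_neg (lt_irrefl _), if_pos h0]
    · obtain ⟨k, hk⟩ := Nat.exists_eq_succ_of_ne_zero hpos.ne'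
      refine ⟨(run P y).cen P.lastBatch ((run (X := X) P y).best P.lastBatch), ?_,
        fun t ht _ => ?_⟩
      · rw [hk]; exact (num_pos_and_best_mem h hX hd hdiam y k).2.2
      · simp only [canonicalPolicy, hf t ht]
        rw [if_neg (lt_irrefl _), if_neg hpos.ne']

lemma isStaticGN_canonicalPolicy (U : Type*) :
    IsStaticGN P (canonicalPolicy (X := X) P U) := by
  refine ⟨respectsGrid_canonicalPolicy P U, fun _ y => run P y,
    fun u y => followsGN_run h hX hd hdiam U u y, fun _ y y' m h1 _ hy => ?_,
    fun _ y y' m _ _ hy => run_best_congr P hy⟩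
  obtain ⟨m, rfl⟩ := Nat.exists_eq_succ_of_ne_zero (by omega : m ≠ 0)
  obtain ⟨e1, e2⟩ := run_congr (X := X) P (m := m) hy
  exact ⟨e1, fun i _ => congrFun e2 i⟩

end Spec

end Run

/-! ### Concentration of the averages -/

section Concentration

variable {Ω : Type*} [MeasurableSpace Ω] {μ : Measure Ω} {ξ : ℕ → Ω → ℝ}

lemma IsNoise.measureReal_abs_sum_gt_le (hξ : IsNoise μ ξ) (s : Finset ℕ) {ε : ℝ} (hε : 0 ≤ ε) :
    μ.real {ω | ε < |∑ t ∈ s, ξ t ω|} ≤ 2 * Real.exp (-ε ^ 2 / (2 * s.card)) := by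
  have : IsProbabilityMeasure μ := hξ.indep.isProbabilityMeasure
  have hs := HasSubgaussianMGF.sum_of_iIndepFun hξ.indep (c := fun _ => 1) (s := s)
    fun t _ => hξ.subgaussian t
  have h1 := hs.measure_ge_le hε
  have h2 := hs.neg.measure_ge_le hε
  simp only [Finset.sum_const, nsmul_eq_mul, mul_one, NNReal.coe_natCast] at h1 h2
  calc μ.real {ω | ε < |∑ t ∈ s, ξ t ω|}
      ≤ μ.real ({ω | ε ≤ ∑ t ∈ s, ξ t ω} ∪ {ω | ε ≤ (-fun ω => ∑ t ∈ s, ξ t ω) ω}) := by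
        refine measureReal_mono fun ω hω => ?_
        rcases lt_abs.1 (show ε < |∑ t ∈ s, ξ t ω| from hω) with h | h
        · exact Or.inl h.le
        · exact Or.inr h.le
    _ ≤ _ := (measureReal_union_le _ _).trans (by linarith)

/-- The event that in each batch the noise averages out over each of the balls provided for. -/
def goodEvent (P : Params) (ξ : ℕ → Ω → ℝ) : Set Ω :=
  {ω | ∀ m ∈ Finset.range P.lastBatch, ∀ i ∈ Finset.range (P.ballCap (m + 1)),
    |∑ k ∈ Finset.range (P.reps (m + 1)), ξ (queryTime P (m + 1) i k) ω| ≤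
      P.reps (m + 1) * (P.lam * P.rad (m + 1) ^ P.q / 2)}

lemma measurableSet_goodEvent (P : Params) (hξ : IsNoise μ ξ) :
    MeasurableSet (goodEvent P ξ) := by
  have hm := hξ.measurable
  have : goodEvent P ξ = ⋂ m ∈ Finset.range P.lastBatch,
      ⋂ i ∈ Finset.range (P.ballCap (m + 1)), {ω |
        |∑ k ∈ Finset.range (P.reps (m + 1)), ξ (queryTime P (m + 1) i k) ω| ≤
          P.reps (m + 1) * (P.lam * P.rad (m + 1) ^ P.q / 2)} := by
    ext ω; simp only [goodEvent, Set.mem_iInter]; rfl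
  rw [this]
  refine Finset.measurableSet_biInter _ fun m _ => Finset.measurableSet_biInter _ fun i _ => ?_
  refine measurableSet_le ?_ measurable_const
  exact (Finset.measurable_fun_sum _ fun k _ => hm _).abs

variable {P : Params}

/-- The tail exponent is `n * λ² * ρ ^ (2q) / 8`, and the 16 in the number of repetitions `n` makes
it at least `2 log T`. -/
lemma measureReal_noise_gt_le (h : P.Valid) (hT : 2 ≤ P.T) (hξ : IsNoise μ ξ) (m i : ℕ) :
    μ.real {ω | P.reps (m + 1) * (P.lam * P.rad (m + 1) ^ P.q / 2) <
      |∑ k ∈ Finset.range (P.reps (m + 1)), ξ (queryTime P (m + 1) i k) ω|} ≤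
      2 / (P.T : ℝ) ^ 2 := by
  have hr := Params.rad_pos h (m + 1)
  have hlam := h.lam_pos
  have hn : (0 : ℝ) < P.reps (m + 1) := by exact_mod_cast Params.reps_pos h hT (m + 1)
  have hTpos : (0 : ℝ) < P.T := by exact_mod_cast (by omega : 0 < P.T)
  have hinj : Function.Injective (queryTime P (m + 1) i) := fun a b hab => by
    simp only [queryTime] at hab; omega
  have key := hξ.measureReal_abs_sum_gt_le
    ((Finset.range (P.reps (m + 1))).image (queryTime P (m + 1) i))
    (ε := P.reps (m + 1) * (P.lam * P.rad (m + 1) ^ P.q / 2)) (by positivity)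
  simp only [Finset.sum_image hinj.injOn] at key
  rw [Finset.card_image_of_injective _ hinj, Finset.card_range] at key
  refine key.trans ?_
  have hceil := Nat.le_ceil (16 * Real.log P.T / (P.lam ^ 2 * P.rad (m + 1) ^ (2 * P.q)))
  rw [← Params.reps, div_le_iff₀ (by positivity)] at hceil
  have hsq : P.rad (m + 1) ^ (2 * P.q) = (P.rad (m + 1) ^ P.q) ^ 2 := by
    rw [← Real.rpow_natCast, ← Real.rpow_mul hr.le]; congr 1; push_cast; ring
  have hexp : -(P.reps (m + 1) * (P.lam * P.rad (m + 1) ^ P.q / 2)) ^ 2 / (2 * P.reps (m + 1)) ≤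
      Real.log (((P.T : ℝ) ^ 2)⁻¹) := by
    rw [Real.log_inv, Real.log_pow, neg_div, neg_le_neg_iff, le_div_iff₀ (by positivity)]
    rw [hsq] at hceil
    push_cast
    nlinarith
  calc 2 * Real.exp _ ≤ 2 * Real.exp (Real.log (((P.T : ℝ) ^ 2)⁻¹)) := by gcongr
    _ = _ := by rw [Real.exp_log (by positivity)]; rfl

/-- With two repetitions per slot there are at most `T / 2` slots, so failure probabilities `2 / T²`
add up to at most `1 / T`, which yields the strict bound `2 / T`. -/
lemma sum_ballCap_le_tau (h2 : ∀ m, 2 ≤ P.reps (m + 1)) (M : ℕ) :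
    2 * ∑ m ∈ Finset.range M, P.ballCap (m + 1) ≤ P.tau M := by
  induction M with
  | zero => simp
  | succ M ih =>
    rw [Finset.sum_range_succ, Params.tau]
    have := Nat.mul_le_mul_left (P.ballCap (M + 1)) (h2 M)
    omega

lemma lt_measureReal_goodEvent (h : P.Valid) (hT : 2 ≤ P.T) (h2 : ∀ m, 2 ≤ P.reps (m + 1))
    (hξ : IsNoise μ ξ) : 1 - 2 / (P.T : ℝ) < μ.real (goodEvent P ξ) := by
  have : IsProbabilityMeasure μ := hξ.indep.isProbabilityMeasure
  have hTpos : (0 : ℝ) < P.T := by exact_mod_cast (by omega : 0 < P.T)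
  have hsub : (goodEvent P ξ)ᶜ ⊆ ⋃ m ∈ Finset.range P.lastBatch,
      ⋃ i ∈ Finset.range (P.ballCap (m + 1)), {ω |
        P.reps (m + 1) * (P.lam * P.rad (m + 1) ^ P.q / 2) <
          |∑ k ∈ Finset.range (P.reps (m + 1)), ξ (queryTime P (m + 1) i k) ω|} := by
    intro ω hω
    rw [Set.mem_compl_iff, goodEvent, Set.mem_ofPred_eq] at hω
    push Not at hω
    obtain ⟨m, hm, i, hi, hlt⟩ := hω
    exact Set.mem_iUnion₂.2 ⟨m, hm, Set.mem_iUnion₂.2 ⟨i, hi, hlt⟩⟩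
  have hbad : μ.real (goodEvent P ξ)ᶜ ≤ 1 / P.T := by
    calc μ.real (goodEvent P ξ)ᶜ
        ≤ ∑ m ∈ Finset.range P.lastBatch, ∑ i ∈ Finset.range (P.ballCap (m + 1)),
            2 / (P.T : ℝ) ^ 2 := by
          refine (measureReal_mono hsub (measure_ne_top _ _)).trans ?_
          refine (measureReal_biUnion_finset_le _ _).trans (Finset.sum_le_sum fun m _ => ?_)
          refine (measureReal_biUnion_finset_le _ _).trans (Finset.sum_le_sum fun i _ => ?_)
          exact measureReal_noise_gt_le h hT hξ m i
      _ = (2 * ∑ m ∈ Finset.range P.lastBatch, P.ballCap (m + 1) : ℕ) / (P.T : ℝ) ^ 2 := by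
          simp only [Finset.sum_const, Finset.card_range, nsmul_eq_mul]
          rw [← Finset.sum_mul]
          push_cast
          ring
      _ ≤ P.T / (P.T : ℝ) ^ 2 := by
          gcongr
          exact (sum_ballCap_le_tau h2 _).trans Params.tau_lastBatch_le
      _ = 1 / P.T := by field_simp
  rw [measureReal_compl (measurableSet_goodEvent P hξ)] at hbad
  have : 1 / (P.T : ℝ) < 2 / P.T := by gcongr; norm_num
  simp at hbad this ⊢
  linarith

end Concentration

/-! ### What Geometric Narrowing plays when the noise averages out -/

section Regret

variable {X : Type*} [MetricSpace X] {P : Params} {tr : Transcript X} {x : ℕ → X}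
  {f : X → ℝ} {xs : X} {y z : ℕ → ℝ}

/-- The noise averages out over each ball that a run queries. -/
def NoiseSmall (P : Params) (z : ℕ → ℝ) : Prop :=
  ∀ m < P.lastBatch, ∀ i < P.ballCap (m + 1),
    |∑ k ∈ Finset.range (P.reps (m + 1)), z (queryTime P (m + 1) i k)| ≤
      P.reps (m + 1) * (P.lam * P.rad (m + 1) ^ P.q / 2)

lemma IsNondegenerate.dist_le_kappa_mul (h : P.Valid) (hf : IsNondegenerate f P.lam P.L P.q xs)
    {c : X} {r : ℝ} (hr : 0 ≤ r) (hc : f c - f xs ≤ (P.lam + P.L) * r ^ P.q) :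
    dist c xs ≤ P.kappa * r := by
  have hlam := h.lam_pos
  have hq : 0 < P.q := by linarith [h.one_le_q]
  have hle := h.lam_le
  have hx : 0 ≤ (P.lam + P.L) / P.lam := by
    have : 0 ≤ P.lam + P.L := by linarith
    positivity
  have h1 := (hf.lower c).trans hc
  have hk : (P.kappa * r) ^ P.q = (P.lam + P.L) / P.lam * r ^ P.q := by
    rw [Params.kappa, Real.mul_rpow (by positivity) hr, ← Real.rpow_mul hx, one_div,
      inv_mul_cancel₀ hq.ne', Real.rpow_one]
  rw [← Real.rpow_le_rpow_iff dist_nonneg _ hq, hk, div_mul_eq_mul_div, le_div_iff₀' hlam]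
  · exact h1
  · have := Params.one_lt_kappa h
    positivity

variable (h : P.Valid) (hT : 2 ≤ P.T) (hGN : FollowsGN P tr x y)
  (hf : IsNondegenerate f P.lam P.L P.q xs)
  (hy : ∀ t, 1 ≤ t → y t = f (x t) + z t) (hz : NoiseSmall P z)
  (hdiam : ∀ a b : X, dist a b ≤ P.diam)

include h hT hGN hy hz in
lemma abs_avgLoss_sub_le {m i : ℕ} (hm : m < P.lastBatch) (hi : i < tr.num (m + 1)) :
    |avgLoss P y (m + 1) i - f (tr.cen (m + 1) i)| ≤ P.lam * P.rad (m + 1) ^ P.q / 2 := by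
  have hn : (0 : ℝ) < P.reps (m + 1) := by exact_mod_cast Params.reps_pos h hT (m + 1)
  have h1 := hz m hm i (hi.trans_le (hGN.count (m + 1) (by omega) hm))
  have h2 : avgLoss P y (m + 1) i - f (tr.cen (m + 1) i) =
      (∑ k ∈ Finset.range (P.reps (m + 1)), z (queryTime P (m + 1) i k)) / P.reps (m + 1) := by
    have : ∑ k ∈ Finset.range (P.reps (m + 1)), y (queryTime P (m + 1) i k) =
        ∑ k ∈ Finset.range (P.reps (m + 1)),
          (f (tr.cen (m + 1) i) + z (queryTime P (m + 1) i k)) := by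
      refine Finset.sum_congr rfl fun k hk => ?_
      rw [hy _ (by rw [queryTime]; omega),
        hGN.query (m + 1) (by omega) hm i hi k (Finset.mem_range.1 hk)]
    rw [avgLoss, this, Finset.sum_add_distrib]
    simp only [Finset.sum_const, Finset.card_range, nsmul_eq_mul]
    field_simp
    ring
  rw [h2, abs_div, abs_of_pos hn, div_le_iff₀' hn]
  exact h1

include h hT hGN hf hy hz in
-- The ball containing the minimizer has a centre of gap at most `L * ρ ^ q`. Two averaging errors
-- of `λ * ρ ^ q / 2` bring the gap of the best centre to at most `(λ + L) * ρ ^ q`, that is, its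
-- distance to at most `κ * ρ`. Points of the minimizer's ball are within `2 * ρ` of the minimizer,
-- so that ball passes the test with threshold `(2 + κ) * ρ`.
lemma dist_best_le {m : ℕ} (hm : m < P.lastBatch) (hxs : xs ∈ tr.region P m) :
    dist (tr.cen (m + 1) (tr.best (m + 1))) xs ≤ P.kappa * P.rad (m + 1) ∧
      xs ∈ tr.region P (m + 1) := by
  have hr := Params.rad_pos h (m + 1)
  have hq : 0 < P.q := by linarith [h.one_le_q]
  have hL : 0 < P.L := h.lam_pos.trans_le h.lam_le
  obtain ⟨i, hi, hxi⟩ := Set.mem_iUnion₂.1 (hGN.cover (m + 1) (by omega) hm hxs)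
  have hdi : dist xs (tr.cen (m + 1) i) ≤ P.rad (m + 1) := hxi
  have hbest := hGN.best_lt (m + 1) (by omega) hm
  have h1 := abs_le.1 (abs_avgLoss_sub_le h hT hGN hy hz hm hi)
  have h2 := abs_le.1 (abs_avgLoss_sub_le h hT hGN hy hz hm hbest)
  have h3 := hGN.best_le (m + 1) (by omega) hm i hi
  have h4 := hf.upper (tr.cen (m + 1) i)
  have h5 : dist (tr.cen (m + 1) i) xs ^ P.q ≤ P.rad (m + 1) ^ P.q := by
    rw [dist_comm]; gcongr
  have h6 := mul_le_mul_of_nonneg_left h5 hL.le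
  have hd : dist (tr.cen (m + 1) (tr.best (m + 1))) xs ≤ P.kappa * P.rad (m + 1) :=
    hf.dist_le_kappa_mul h hr.le (by linarith)
  refine ⟨hd, Set.mem_iUnion₂.2 ⟨i, ⟨hi, fun w hw => ?_⟩, hxi⟩⟩
  have hw' : dist w (tr.cen (m + 1) i) ≤ P.rad (m + 1) := hw
  have e1 := dist_triangle w (tr.cen (m + 1) i) xs
  have e2 := dist_triangle w xs (tr.cen (m + 1) (tr.best (m + 1)))
  rw [dist_comm] at hdi
  rw [dist_comm xs] at e2
  linarith

include h hT hGN hf hy hz in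
lemma minimizer_mem_region {m : ℕ} (hm : m ≤ P.lastBatch) : xs ∈ tr.region P m := by
  induction m with
  | zero => trivial
  | succ m ih => exact (dist_best_le h hT hGN hf hy hz hm (ih (by omega))).2

include h hT hGN hf hy hz hdiam in
lemma dist_le_of_mem_region {m : ℕ} (hm : m ≤ P.lastBatch) {w : X} (hw : w ∈ tr.region P m) :
    dist w xs ≤ (2 + 2 * P.kappa) * P.rad m := by
  have hk := Params.one_lt_kappa h
  have hr := Params.rad_pos h m
  rcases m with _ | m
  · rw [Params.rad_zero] at *
    have := hdiam w xs
    nlinarith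
  · obtain ⟨i, hi, hwi⟩ := Set.mem_iUnion₂.1 hw
    have h1 := hi.2 w hwi
    have h2 := (dist_best_le h hT hGN hf hy hz hm
      (minimizer_mem_region h hT hGN hf hy hz (by omega))).1
    have h3 := dist_triangle w (tr.cen (m + 1) (tr.best (m + 1))) xs
    linarith

include hGN in
-- A step is either surplus or a query, whose slot and repetition are recovered by division with
-- remainder by `reps`.
lemma exists_mem_ball {m t : ℕ} (hm : m < P.lastBatch) (h1 : P.tau m < t)
    (h2 : t ≤ P.tau (m + 1)) (hr : 0 ≤ P.rad (m + 1)) :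
    ∃ i < tr.num (m + 1), x t ∈ tr.ball P (m + 1) i := by
  rcases le_or_gt t (P.tau m + tr.num (m + 1) * P.reps (m + 1)) with h3 | h3
  · have hn : 0 < P.reps (m + 1) := by
      by_contra hn
      have : P.reps (m + 1) = 0 := by omega
      rw [this] at h3
      omega
    have hdm := Nat.div_add_mod (t - P.tau m - 1) (P.reps (m + 1))
    have hmod := Nat.mod_lt (t - P.tau m - 1) hn
    have hi : (t - P.tau m - 1) / P.reps (m + 1) < tr.num (m + 1) := by
      rw [Nat.div_lt_iff_lt_mul hn]; omega
    have hq := hGN.query (m + 1) (by omega) hm _ hi _ hmod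
    have hqt : queryTime P (m + 1) ((t - P.tau m - 1) / P.reps (m + 1))
        ((t - P.tau m - 1) % P.reps (m + 1)) = t := by
      rw [queryTime, Nat.add_sub_cancel, mul_comm]; omega
    rw [hqt] at hq
    exact ⟨_, hi, by rw [hq]; exact Metric.mem_closedBall_self hr⟩
  · exact hGN.excess (m + 1) (by omega) hm t h3 h2

include h hT hGN hf hy hz hdiam in
lemma dist_le_of_mem_batch {m t : ℕ} (hm : m < P.lastBatch) (h1 : P.tau m < t)
    (h2 : t ≤ P.tau (m + 1)) : dist (x t) xs ≤ (4 + 2 * P.kappa) * P.rad m := by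
  have hr := Params.rad_pos h (m + 1)
  obtain ⟨i, hi, hxi⟩ := exists_mem_ball hGN hm h1 h2 hr.le
  obtain ⟨w, hw, hwr⟩ := hGN.meets (m + 1) (by omega) hm i hi
  have h3 := dist_le_of_mem_region h hT hGN hf hy hz hdiam hm.le hwr
  have h4 : dist (x t) (tr.cen (m + 1) i) ≤ P.rad (m + 1) := hxi
  have h5 : dist w (tr.cen (m + 1) i) ≤ P.rad (m + 1) := hw
  have h6 := dist_triangle (x t) (tr.cen (m + 1) i) xs
  have h7 := dist_triangle (tr.cen (m + 1) i) w xs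
  -- The ball meets the old region, so at most two new radii are added to `(2 + 2κ) * rad m`.
  have h8 := Params.rad_anti h (Nat.le_add_right m 1)
  rw [dist_comm (tr.cen (m + 1) i) w] at h7
  linarith

/-- The largest ratio of the regret of a step to the `q`-th power of the previous radius. -/
noncomputable def stepConst (P : Params) : ℝ := P.L * (4 + 2 * P.kappa) ^ P.q

include h in
lemma stepConst_pos : 0 < stepConst P := by
  have hk := Params.one_lt_kappa h
  have hL : 0 < P.L := h.lam_pos.trans_le h.lam_le
  rw [stepConst]; positivity

include h hf in
lemma gap_le {w : X} {r : ℝ} (hr : 0 ≤ r) (hw : dist w xs ≤ (4 + 2 * P.kappa) * r) :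
    f w - f xs ≤ stepConst P * r ^ P.q := by
  have hk := Params.one_lt_kappa h
  have hL : 0 < P.L := h.lam_pos.trans_le h.lam_le
  have hq : 0 < P.q := by linarith [h.one_le_q]
  rw [stepConst, mul_assoc, ← Real.mul_rpow (by positivity) hr]
  refine (hf.upper w).trans ?_
  gcongr

include h hT hGN hf hy hz hdiam in
lemma sum_gap_le : ∑ t ∈ Finset.Icc 1 P.T, (f (x t) - f xs) ≤
    stepConst P * (∑ m ∈ Finset.range P.lastBatch,
        (P.ballCap (m + 1) * P.reps (m + 1) : ℝ) * P.rad m ^ P.q +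
      (P.T - P.tau P.lastBatch : ℝ) * P.rad P.lastBatch ^ P.q) := by
  have hbatch : ∀ M ≤ P.lastBatch, ∑ t ∈ Finset.Ioc 0 (P.tau M), (f (x t) - f xs) ≤
      stepConst P * ∑ m ∈ Finset.range M,
        (P.ballCap (m + 1) * P.reps (m + 1) : ℝ) * P.rad m ^ P.q := by
    intro M hM
    induction M with
    | zero => simp [Params.tau]
    | succ M ih =>
      rw [← Finset.sum_Ioc_consecutive _ (Nat.zero_le (P.tau M))
        (Params.tau_mono (Nat.le_add_right M 1)), Finset.sum_range_succ, mul_add]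
      refine add_le_add (ih (by omega)) ?_
      refine (Finset.sum_le_card_nsmul _ _ (stepConst P * P.rad M ^ P.q) fun t ht => ?_).trans_eq ?_
      · rw [Finset.mem_Ioc] at ht
        exact gap_le h hf (Params.rad_pos h M).le
          (dist_le_of_mem_batch h hT hGN hf hy hz hdiam hM ht.1 ht.2)
      · rw [Nat.card_Ioc, Params.tau, Nat.add_sub_cancel_left, nsmul_eq_mul]
        push_cast
        ring
  have hclean : ∑ t ∈ Finset.Ioc (P.tau P.lastBatch) P.T, (f (x t) - f xs) ≤
      stepConst P * ((P.T - P.tau P.lastBatch : ℝ) * P.rad P.lastBatch ^ P.q) := by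
    obtain ⟨p, hp, hpx⟩ := hGN.cleanup
    refine (Finset.sum_le_card_nsmul _ _ (stepConst P * P.rad P.lastBatch ^ P.q)
      fun t ht => ?_).trans_eq ?_
    · rw [Finset.mem_Ioc] at ht
      rw [hpx t ht.1 ht.2]
      have hr := Params.rad_pos h P.lastBatch
      refine gap_le h hf hr.le
        ((dist_le_of_mem_region h hT hGN hf hy hz hdiam le_rfl hp).trans ?_)
      nlinarith
    · rw [Nat.card_Ioc, nsmul_eq_mul, Nat.cast_sub Params.tau_lastBatch_le]
      ring
  have hIcc : Finset.Icc 1 P.T = Finset.Ioc 0 P.T := by ext t; simp; omega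
  rw [hIcc, ← Finset.sum_Ioc_consecutive _ (Nat.zero_le (P.tau P.lastBatch))
    Params.tau_lastBatch_le, mul_add]
  exact add_le_add (hbatch _ le_rfl) hclean

end Regret

/-! ### The size of the bound -/

namespace Params

variable {P : Params} (h : P.Valid) (hT : 2 ≤ P.T)

include hT in
lemma two_rpow_logRatio :
    (2 : ℝ) ^ (P.logRatio / (2 * Real.log 2)) = Real.sqrt (P.T / Real.log P.T) := by
  have h2 : Real.log 2 ≠ 0 := (Real.log_pos (by norm_num)).ne'
  have hl := log_T_pos hT
  have hTpos : (0 : ℝ) < P.T := by exact_mod_cast (by omega : 0 < P.T)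
  rw [Real.rpow_def_of_pos (by norm_num), Real.sqrt_eq_rpow,
    Real.rpow_def_of_pos (by positivity), logRatio]
  congr 1
  field_simp

include hT in
lemma log_mul_sqrt :
    Real.log P.T * Real.sqrt (P.T / Real.log P.T) = Real.sqrt (P.T * Real.log P.T) := by
  have hl := log_T_pos hT
  have hTpos : (0 : ℝ) < P.T := by exact_mod_cast (by omega : 0 < P.T)
  nth_rw 1 [← Real.sqrt_sq hl.le]
  rw [← Real.sqrt_mul (by positivity)]
  congr 1
  field_simp

/-- The factor in front of the regret bound of a batch that does not depend on `d`. -/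
noncomputable def batchConst (P : Params) : ℝ :=
  2 * (16 / P.lam ^ 2 + P.diam ^ (2 * P.q) / Real.log 2) * (P.diam ^ P.q)⁻¹ * 2 ^ (2 * P.q)

include h in
lemma batchConst_pos : 0 < P.batchConst := by
  have h2 : 0 < Real.log 2 := Real.log_pos (by norm_num)
  have := h.lam_pos
  have := h.diam_pos
  rw [batchConst]; positivity

include h hT in
lemma batch_cost_le (m : ℕ) :
    (P.ballCap (m + 1) * P.reps (m + 1) : ℝ) * P.rad m ^ P.q ≤
      P.batchConst * (2 * P.bConst) ^ P.d * Real.sqrt (P.T * Real.log P.T) := by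
  have hD := h.diam_pos
  have hlam := h.lam_pos
  have h2 : 0 < Real.log 2 := Real.log_pos (by norm_num)
  have hl := log_T_pos hT
  have hr := rad_pos h m
  have hr' := rad_pos h (m + 1)
  have hB : 0 < P.bConst := zero_lt_one.trans_le (one_le_bConst h)
  have htrade := batchExp_tradeoff h m
  have hz : ∀ k : ℤ, ∀ a : ℝ, ((2 : ℝ) ^ k) ^ a = (2 : ℝ) ^ (k * a) := fun k a => by
    rw [← Real.rpow_intCast, ← Real.rpow_mul (by norm_num)]
  have hpow : ((2 : ℝ) ^ (P.batchExp (m + 1) - P.batchExp m)) ^ P.d *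
      ((P.rad (m + 1) ^ (2 * P.q))⁻¹ * P.rad m ^ P.q) ≤
      (P.diam ^ P.q)⁻¹ * (2 ^ (2 * P.q) * 2 ^ P.d * Real.sqrt (P.T / Real.log P.T)) := by
    have e1 : P.rad (m + 1) ^ (2 * P.q) = (P.diam ^ P.q) ^ 2 *
        (2 : ℝ) ^ (-(P.batchExp (m + 1) : ℝ) * (2 * P.q)) := by
      rw [rad_eq, Real.mul_rpow hD.le (by positivity), hz, ← Real.rpow_natCast,
        ← Real.rpow_mul hD.le]
      push_cast
      congr 2; ring
    have e2 : P.rad m ^ P.q = P.diam ^ P.q * (2 : ℝ) ^ (-(P.batchExp m : ℝ) * P.q) := by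
      rw [rad_eq, Real.mul_rpow hD.le (by positivity), hz]
      push_cast
      rfl
    have hDq : 0 < P.diam ^ P.q := by positivity
    have e3 : ((2 : ℝ) ^ (P.batchExp (m + 1) - P.batchExp m)) ^ P.d *
      ((P.rad (m + 1) ^ (2 * P.q))⁻¹ * P.rad m ^ P.q) = (P.diam ^ P.q)⁻¹ *
        (2 : ℝ) ^ ((2 * P.q + P.d) * P.batchExp (m + 1) - (P.q + P.d) * P.batchExp m) := by
      rw [e1, e2, hz, mul_inv, ← Real.rpow_neg (by norm_num)]
      have : (2 * P.q + P.d) * P.batchExp (m + 1) - (P.q + P.d) * P.batchExp m =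
        ((P.batchExp (m + 1) - P.batchExp m : ℤ) : ℝ) * P.d +
          (-(-(P.batchExp (m + 1) : ℝ) * (2 * P.q)) + -(P.batchExp m : ℝ) * P.q) := by
        push_cast; ring
      rw [this, Real.rpow_add (by norm_num), Real.rpow_add (by norm_num)]
      field_simp
    rw [e3, ← two_rpow_logRatio hT, ← Real.rpow_add (by norm_num), ← Real.rpow_add (by norm_num)]
    gcongr
    · norm_num
    · linarith
  have hcap := ballCap_le h m
  have hreps := reps_le h hT (m + 1)
  calc (P.ballCap (m + 1) * P.reps (m + 1) : ℝ) * P.rad m ^ P.q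
      ≤ (2 * (((2 : ℝ) ^ (P.batchExp (m + 1) - P.batchExp m)) ^ P.d * P.bConst ^ P.d) *
        ((16 / P.lam ^ 2 + P.diam ^ (2 * P.q) / Real.log 2) * Real.log P.T /
          P.rad (m + 1) ^ (2 * P.q))) * P.rad m ^ P.q := by gcongr
    _ = 2 * (16 / P.lam ^ 2 + P.diam ^ (2 * P.q) / Real.log 2) * P.bConst ^ P.d * Real.log P.T *
        (((2 : ℝ) ^ (P.batchExp (m + 1) - P.batchExp m)) ^ P.d *
          ((P.rad (m + 1) ^ (2 * P.q))⁻¹ * P.rad m ^ P.q)) := by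
        rw [div_eq_mul_inv _ (P.rad (m + 1) ^ (2 * P.q))]; ring
    _ ≤ 2 * (16 / P.lam ^ 2 + P.diam ^ (2 * P.q) / Real.log 2) * P.bConst ^ P.d * Real.log P.T *
        ((P.diam ^ P.q)⁻¹ * (2 ^ (2 * P.q) * 2 ^ P.d * Real.sqrt (P.T / Real.log P.T))) := by
        gcongr
    _ = _ := by
        rw [← log_mul_sqrt hT, batchConst, Real.mul_rpow (by norm_num) hB.le]; ring

include h hT in
lemma cleanup_cost_le : (P.T - P.tau P.lastBatch : ℝ) * P.rad P.lastBatch ^ P.q ≤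
    (P.batchConst + 2 * P.diam ^ P.q) * (2 * P.bConst) ^ P.d *
      Real.sqrt (P.T * Real.log P.T) := by
  have hD := h.diam_pos
  have hl := log_T_pos hT
  have hTpos : (0 : ℝ) < P.T := by exact_mod_cast (by omega : 0 < P.T)
  have hr := rad_pos h P.lastBatch
  have hB : 1 ≤ (2 * P.bConst) ^ P.d :=
    Real.one_le_rpow (by linarith [one_le_bConst h]) h.d_nonneg
  have hbc := batchConst_pos h
  have hq : 0 < P.q := by linarith [h.one_le_q]
  rcases (lastBatch_le (P := P)).lt_or_eq with hlt | heq
  · have h1 := lt_tau_of_lastBatch_lt hlt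
    have h2 : (P.T - P.tau P.lastBatch : ℝ) ≤
        P.ballCap (P.lastBatch + 1) * P.reps (P.lastBatch + 1) := by
      rw [tau] at h1
      have : (P.T : ℝ) ≤ (P.tau P.lastBatch +
        P.ballCap (P.lastBatch + 1) * P.reps (P.lastBatch + 1) : ℕ) := by exact_mod_cast h1.le
      push_cast at this
      linarith
    calc (P.T - P.tau P.lastBatch : ℝ) * P.rad P.lastBatch ^ P.q
        ≤ (P.ballCap (P.lastBatch + 1) * P.reps (P.lastBatch + 1) : ℝ) *
          P.rad P.lastBatch ^ P.q := by gcongr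
      _ ≤ _ := batch_cost_le h hT _
      _ ≤ _ := by
        gcongr
        have : 0 < P.diam ^ P.q := by positivity
        linarith
  · have hln2 : 0 < Real.log 2 := Real.log_pos (by norm_num)
    have hS : P.logRatio / (2 * Real.log 2) - 1 ≤ P.q * P.batchExp P.lastBatch := by
      rw [heq, batchExp_even h]
      have h1 := mul_le_mul_of_nonneg_left (Int.le_ceil (P.cSum P.mHat)) hq.le
      rw [q_mul_cSum h] at h1
      -- `2 log 2` exceeds 1, so the bound by 1 from the choice of `M̂` is enough.
      have h2 : P.eta ^ P.mHat * (P.logRatio / (2 * Real.log 2)) ≤ 1 := by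
        rw [← mul_div_assoc, div_le_one (by positivity)]
        linarith [eta_pow_mHat h hT, Real.log_two_gt_d9]
      linarith
    have hrad : P.rad P.lastBatch ^ P.q ≤
        P.diam ^ P.q * (2 * (Real.sqrt (P.T / Real.log P.T))⁻¹) := by
      rw [rad_eq, Real.mul_rpow hD.le (by positivity), ← two_rpow_logRatio hT,
        ← Real.rpow_intCast, ← Real.rpow_mul (by norm_num), ← Real.rpow_neg (by norm_num)]
      have : (2 : ℝ) * 2 ^ (-(P.logRatio / (2 * Real.log 2))) =
          2 ^ (1 + -(P.logRatio / (2 * Real.log 2))) := by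
        rw [Real.rpow_add (by norm_num), Real.rpow_one]
      rw [this]
      gcongr
      · norm_num
      · push_cast; linarith
    have hsq : (P.T : ℝ) * (Real.sqrt (P.T / Real.log P.T))⁻¹ =
        Real.sqrt (P.T * Real.log P.T) := by
      rw [← log_mul_sqrt hT, ← div_eq_mul_inv, div_eq_iff (by positivity), mul_assoc,
        Real.mul_self_sqrt (by positivity)]
      field_simp
    calc (P.T - P.tau P.lastBatch : ℝ) * P.rad P.lastBatch ^ P.q
        ≤ P.T * (P.diam ^ P.q * (2 * (Real.sqrt (P.T / Real.log P.T))⁻¹)) := by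
          gcongr
          have : (0 : ℝ) ≤ P.tau P.lastBatch := Nat.cast_nonneg _
          linarith
      _ = 2 * P.diam ^ P.q * 1 * Real.sqrt (P.T * Real.log P.T) := by rw [← hsq]; ring
      _ ≤ _ := by gcongr; linarith

end Params

/-! ### Policies and their losses -/

lemma Params.lastComm_lt (P : Params) {t : ℕ} (ht : 1 ≤ t) : P.lastComm t < t :=
  Nat.findGreatest_spec (P := fun m => P.tau m < t) (m := 0) (Nat.zero_le _) ht

section Policy

variable {X U : Type*} {P : Params} {π : Policy X U} (f : X → ℝ) (u : U) (z : ℕ → ℝ)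

/-- The truncation of the losses at `t` is invisible to a batched policy. The interaction may thus
be read as the policy applied to one fixed loss sequence, the form in which `FollowsGN` is stated.
-/
lemma RespectsGrid.played_eq (hπ : RespectsGrid P π) {t : ℕ} (ht : 1 ≤ t) :
    played π f u z t = π t u (losses π f u z) :=
  hπ t u _ _ ht fun _ _ hs => if_pos (hs.trans_lt (P.lastComm_lt ht))

lemma losses_eq (π : Policy X U) (t : ℕ) : losses π f u z t = f (played π f u z t) + z t := by
  rw [losses, played]
  simp only [dite_eq_ite]

end Policy

/-! ### The number of batches and the constants -/

namespace Params

variable {P : Params} (h : P.Valid)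

/-- The factor between the number of batches and `(1 + d) log log (T / log T)`. -/
noncomputable def batchesConst : ℝ := 2 / Real.log 2 + 4 / Real.log minLogRatio

lemma log_minLogRatio_pos : 0 < Real.log minLogRatio := Real.log_pos one_lt_minLogRatio

lemma batchesConst_pos : 0 < batchesConst := by
  have h2 : 0 < Real.log 2 := Real.log_pos (by norm_num)
  have := log_minLogRatio_pos
  rw [batchesConst]; positivity

lemma log_minLogRatio_le (hT : 2 ≤ P.T) : Real.log minLogRatio ≤ Real.log P.logRatio :=
  Real.log_le_log (zero_lt_one.trans one_lt_minLogRatio) (minLogRatio_le hT)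

include h in
lemma lastBatch_add_one_le (hT : 2 ≤ P.T) :
    (P.lastBatch : ℝ) + 1 ≤ batchesConst * (1 + P.d) * Real.log P.logRatio := by
  have h1 : (P.lastBatch : ℝ) ≤ 2 * P.mHat := by exact_mod_cast lastBatch_le (P := P)
  have h2 := mHat_le h hT
  have hc := log_minLogRatio_pos
  have h3 : 1 ≤ 1 / Real.log minLogRatio * Real.log P.logRatio := by
    rw [one_div, ← div_eq_inv_mul, one_le_div hc]; exact log_minLogRatio_le hT
  have hd := h.d_nonneg
  have h4 : 4 ≤ 4 * (1 + P.d) * (1 / Real.log minLogRatio * Real.log P.logRatio) := by nlinarith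
  have : batchesConst * (1 + P.d) * Real.log P.logRatio =
      2 * ((1 + P.d) / Real.log 2 * Real.log P.logRatio) +
        4 * (1 + P.d) * (1 / Real.log minLogRatio * Real.log P.logRatio) := by
    rw [batchesConst]; ring
  rw [this]
  linarith

lemma log_logRatio_le (hT : 3 ≤ P.T) : Real.log P.logRatio ≤ Real.log (Real.log P.T) := by
  have h3 : (3 : ℝ) ≤ P.T := by exact_mod_cast hT
  have hlog : 1 ≤ Real.log P.T := by
    rw [Real.le_log_iff_exp_le (by linarith)]
    linarith [Real.exp_one_lt_d9]
  have hr := one_lt_logRatio (P := P) (by omega)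
  refine Real.log_le_log (by linarith) (Real.log_le_log (by positivity) ?_)
  exact div_le_self (by linarith) hlog

/-- Moves the factor `1 + d` in the number of batches into the exponential one, turning `2 * B` into
`4 * B`. -/
lemma one_add_le_two_mul_two_rpow {d : ℝ} (hd : 0 ≤ d) : 1 + d ≤ 2 * (2 : ℝ) ^ d := by
  rw [Real.rpow_def_of_pos (by norm_num)]
  have := Real.add_one_le_exp (Real.log 2 * d)
  nlinarith [Real.log_two_gt_d9]

include h in
-- The threshold on `T` does not involve `d`, so the horizons below it can be handled by a constant.
lemma two_le_reps (hT : Real.exp (P.lam ^ 2 * P.diam ^ (2 * P.q) / 16) < P.T) (m : ℕ) :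
    2 ≤ P.reps m := by
  have hT0 : (0 : ℝ) < P.T := (Real.exp_pos _).trans hT
  have hr := rad_pos h m
  have hlam := h.lam_pos
  have hq := h.one_le_q
  rw [← Real.lt_log_iff_exp_lt hT0] at hT
  have h1 : P.rad m ^ (2 * P.q) ≤ P.diam ^ (2 * P.q) :=
    Real.rpow_le_rpow hr.le (rad_le_diam h m) (by linarith)
  have h2 : P.lam ^ 2 * P.rad m ^ (2 * P.q) ≤ P.lam ^ 2 * P.diam ^ (2 * P.q) := by gcongr
  refine Nat.succ_le_of_lt (Nat.lt_ceil.2 ?_)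
  rw [Nat.cast_one, one_lt_div (by positivity)]
  linarith

lemma one_le_sqrt (hT : 2 ≤ P.T) : 1 ≤ Real.sqrt (P.T * Real.log P.T) := by
  rw [Real.one_le_sqrt]
  have h2 : (2 : ℝ) ≤ P.T := by exact_mod_cast hT
  have h3 := Real.log_le_log (by norm_num) h2
  nlinarith [Real.log_two_gt_d9]

/-- The regret constant for long horizons. -/
noncomputable def regretConst (P : Params) : ℝ :=
  stepConst P * (P.batchConst + 2 * P.diam ^ P.q) * (2 * batchesConst)

include h in
lemma regretConst_pos : 0 < P.regretConst := by
  have := stepConst_pos h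
  have := batchConst_pos h
  have := h.diam_pos
  have := batchesConst_pos
  rw [regretConst]; positivity

/-- The regret constant for short horizons. -/
noncomputable def shortConst (P : Params) : ℝ :=
  Real.exp (P.lam ^ 2 * P.diam ^ (2 * P.q) / 16) * (P.L * P.diam ^ P.q) / Real.log minLogRatio

include h in
lemma shortConst_pos : 0 < P.shortConst := by
  have := h.diam_pos
  have := h.lam_pos.trans_le h.lam_le
  have := log_minLogRatio_pos
  rw [shortConst]; positivity

end Params

/-! ### The regret bound for long and short horizons -/

section Bound

variable {X : Type*} [MetricSpace X] {P : Params} {f : X → ℝ} {xs : X} {x : ℕ → X}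
  (h : P.Valid) (hT : 2 ≤ P.T) (hf : IsNondegenerate f P.lam P.L P.q xs)
  (hdiam : ∀ a b : X, dist a b ≤ P.diam)

include h hT hf hdiam

lemma FollowsGN.sum_gap_le_of_noiseSmall {tr : Transcript X} {y z : ℕ → ℝ}
    (hGN : FollowsGN P tr x y) (hy : ∀ t, 1 ≤ t → y t = f (x t) + z t) (hz : NoiseSmall P z) :
    ∑ t ∈ Finset.Icc 1 P.T, (f (x t) - f xs) ≤ P.regretConst * (4 * P.bConst) ^ P.d *
      Real.sqrt (P.T * Real.log P.T) * Real.log P.logRatio := by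
  have hW := stepConst_pos h
  have hD := h.diam_pos
  have hB : 0 < P.bConst := zero_lt_one.trans_le (Params.one_le_bConst h)
  have hbc := Params.batchConst_pos h
  have hC := Params.batchesConst_pos
  have hll := Real.log_pos (Params.one_lt_logRatio hT)
  set S := Real.sqrt (P.T * Real.log P.T)
  have hS : 0 ≤ S := Real.sqrt_nonneg _
  set Q := (P.batchConst + 2 * P.diam ^ P.q) * (2 * P.bConst) ^ P.d * S with hQ
  have hbatch : ∑ m ∈ Finset.range P.lastBatch,
      (P.ballCap (m + 1) * P.reps (m + 1) : ℝ) * P.rad m ^ P.q ≤ P.lastBatch * Q := by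
    refine (Finset.sum_le_card_nsmul _ _ Q fun m _ =>
      (Params.batch_cost_le h hT m).trans ?_).trans_eq (by rw [Finset.card_range, nsmul_eq_mul])
    rw [hQ]
    gcongr
    have : 0 < P.diam ^ P.q := by positivity
    linarith
  have hcount := Params.lastBatch_add_one_le h hT
  have hd := Params.one_add_le_two_mul_two_rpow h.d_nonneg
  calc ∑ t ∈ Finset.Icc 1 P.T, (f (x t) - f xs)
      ≤ stepConst P * (P.lastBatch * Q + Q) := by
        refine (sum_gap_le h hT hGN hf hy hz hdiam).trans ?_
        gcongr
        exact Params.cleanup_cost_le h hT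
    _ = stepConst P * Q * (P.lastBatch + 1) := by ring
    _ ≤ stepConst P * Q *
          (Params.batchesConst * (2 * (2 : ℝ) ^ P.d) * Real.log P.logRatio) := by
        gcongr
        refine hcount.trans ?_
        gcongr
    _ = _ := by
        rw [hQ, Params.regretConst, show 4 * P.bConst = 2 * (2 * P.bConst) by ring,
          Real.mul_rpow (x := 2) (y := 2 * P.bConst) (by norm_num) (by positivity)]
        ring

/-- Each step costs at most `L * diam ^ q` and `T` is bounded, while the remaining factors on the
right are bounded below, the last by `log minLogRatio`. -/
lemma sum_gap_le_of_short
    (hshort : (P.T : ℝ) ≤ Real.exp (P.lam ^ 2 * P.diam ^ (2 * P.q) / 16)) :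
    ∑ t ∈ Finset.Icc 1 P.T, (f (x t) - f xs) ≤ P.shortConst * (4 * P.bConst) ^ P.d *
      Real.sqrt (P.T * Real.log P.T) * Real.log P.logRatio := by
  have hL := h.lam_pos.trans_le h.lam_le
  have hD := h.diam_pos
  have hq : 0 < P.q := by linarith [h.one_le_q]
  have hc := Params.log_minLogRatio_pos
  have hA : 1 ≤ (4 * P.bConst) ^ P.d :=
    Real.one_le_rpow (by linarith [Params.one_le_bConst h]) h.d_nonneg
  have hS := Params.one_le_sqrt hT
  have hK := Params.shortConst_pos h
  calc ∑ t ∈ Finset.Icc 1 P.T, (f (x t) - f xs)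
      ≤ P.T * (P.L * P.diam ^ P.q) := by
        refine (Finset.sum_le_card_nsmul _ _ (P.L * P.diam ^ P.q) fun t _ => ?_).trans_eq
          (by rw [Nat.card_Icc, nsmul_eq_mul, Nat.add_sub_cancel])
        refine (hf.upper _).trans ?_
        gcongr
        exact hdiam _ _
    _ ≤ Real.exp (P.lam ^ 2 * P.diam ^ (2 * P.q) / 16) * (P.L * P.diam ^ P.q) := by gcongr
    _ = P.shortConst * 1 * 1 * Real.log minLogRatio := by rw [Params.shortConst]; field_simp
    _ ≤ _ := by
        refine mul_le_mul ?_ (Params.log_minLogRatio_le hT) hc.le (by positivity)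
        gcongr

/-- The regret bound, with the constant for all horizons. -/
lemma IsStaticGN.exists_event {U Ω : Type*} [MeasurableSpace Ω] {μ : Measure Ω}
    [IsProbabilityMeasure μ] {ξ : ℕ → Ω → ℝ} {π : Policy X U} (hπ : IsStaticGN P π)
    (seed : Ω → U) (hξ : IsNoise μ ξ) :
    ∃ E : Set Ω, MeasurableSet E ∧ 1 - 2 / (P.T : ℝ) < μ.real E ∧
      ∀ ω ∈ E, regret π f xs (seed ω) (fun t => ξ t ω) P.T ≤
        (P.regretConst + P.shortConst) * (4 * P.bConst) ^ P.d *
          Real.sqrt (P.T * Real.log P.T) * Real.log P.logRatio := by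
  have hll := Real.log_pos (Params.one_lt_logRatio hT)
  have hB : 0 < P.bConst := zero_lt_one.trans_le (Params.one_le_bConst h)
  have hK1 := Params.regretConst_pos h
  have hK2 := Params.shortConst_pos h
  rcases le_or_gt (P.T : ℝ) (Real.exp (P.lam ^ 2 * P.diam ^ (2 * P.q) / 16)) with hs | hs
  · refine ⟨Set.univ, MeasurableSet.univ, ?_, fun ω _ => ?_⟩
    · have : (0 : ℝ) < P.T := by exact_mod_cast (by omega : 0 < P.T)
      have : 0 < 2 / (P.T : ℝ) := by positivity
      simp only [probReal_univ]
      linarith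
    · refine (sum_gap_le_of_short h hT hf hdiam hs).trans ?_
      gcongr
      linarith
  · refine ⟨goodEvent P ξ, measurableSet_goodEvent P hξ,
      lt_measureReal_goodEvent h hT (fun m => Params.two_le_reps h hs _) hξ, fun ω hω => ?_⟩
    obtain ⟨hgrid, rec, hrec, -, -⟩ := hπ
    set y := losses π f (seed ω) (fun t => ξ t ω) with hy
    have hplay : ∀ t, 1 ≤ t → played π f (seed ω) (fun t => ξ t ω) t = π t (seed ω) y :=
      fun t ht => hgrid.played_eq f _ _ ht
    have key := (hrec (seed ω) y).sum_gap_le_of_noiseSmall h hT hf hdiam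
      (z := fun t => ξ t ω) (fun t ht => by rw [← hplay t ht, hy, losses_eq])
      (fun m hm i hi => hω m (Finset.mem_range.2 hm) i (Finset.mem_range.2 hi))
    have hreg : regret π f xs (seed ω) (fun t => ξ t ω) P.T =
        ∑ t ∈ Finset.Icc 1 P.T, (f (π t (seed ω) y) - f xs) := by
      refine Finset.sum_congr rfl fun t ht => ?_
      rw [hplay t (Finset.mem_Icc.1 ht).1]
    rw [hreg]
    refine key.trans ?_
    gcongr
    linarith

end Bound

end StaticGN

/-- All constants depend on the nondegeneracy parameters and on the diameter only. The random seed
of the policy is an arbitrary function on the sample space: no independence is needed. -/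
theorem corollary4 (lam L q Δ : ℝ) (hlam : 0 < lam) (hL : lam ≤ L) (hq : 1 ≤ q) (hΔ : 0 < Δ) :
    ∃ K A C : ℝ, 0 < K ∧ 0 < A ∧ 0 < C ∧
      ∀ (X : Type*) [MetricSpace X] [CompactSpace X], StaticGN.IsDoubling X →
        Metric.diam (Set.univ : Set X) = Δ →
      ∀ (T : ℕ), 1 ≤ T →
      ∀ (P : StaticGN.Params), P = ⟨lam, L, q, Δ, StaticGN.doublingDim X, T⟩ →
        -- the grid is admissible and consists of `O(log log T)` points
        (P.tau 0 = 0 ∧ StrictMonoOn P.tau (Set.Iic P.lastBatch) ∧ P.tau P.lastBatch ≤ T) ∧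
        (3 ≤ T → (P.lastBatch : ℝ) + 1 ≤
          C * (1 + StaticGN.doublingDim X) * Real.log (Real.log T)) ∧
        ∀ (U : Type*),
          -- the algorithm can be run on the grid
          (∃ π : StaticGN.Policy X U, StaticGN.IsStaticGN P π) ∧
          -- however it is run, its regret is bounded
          ∀ π : StaticGN.Policy X U, StaticGN.IsStaticGN P π →
          ∀ (f : X → ℝ) (xs : X), StaticGN.IsNondegenerate f lam L q xs →
          ∀ (Ω : Type*) [MeasurableSpace Ω] (μ : MeasureTheory.Measure Ω)
            [MeasureTheory.IsProbabilityMeasure μ] (ξ : ℕ → Ω → ℝ) (seed : Ω → U),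
            StaticGN.IsNoise μ ξ →
            ∃ E : Set Ω, MeasurableSet E ∧ 1 - 2 / (T : ℝ) < μ.real E ∧
              ∀ ω ∈ E, StaticGN.regret π f xs (seed ω) (fun t => ξ t ω) T ≤
                K * A ^ StaticGN.doublingDim X * Real.sqrt (T * Real.log T) *
                  Real.log (Real.log (T / Real.log T)) := by
  -- The constants do not look at `d` or `T`, so they can be read off from dummy values; for the
  -- actual parameters they are definitionally the same.
  let P₀ : StaticGN.Params := ⟨lam, L, q, Δ, 0, 1⟩
  have h₀ : P₀.Valid := ⟨hlam, hL, hq, hΔ, le_rfl, le_rfl⟩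
  have hB := StaticGN.Params.one_le_bConst h₀
  refine ⟨P₀.regretConst + P₀.shortConst, 4 * P₀.bConst, StaticGN.Params.batchesConst,
    add_pos (StaticGN.Params.regretConst_pos h₀) (StaticGN.Params.shortConst_pos h₀),
    by linarith, StaticGN.Params.batchesConst_pos, ?_⟩
  intro X _ _ hX hdiam T hT P hP
  have : Nonempty X := by
    by_contra hne
    rw [not_nonempty_iff] at hne
    rw [Set.univ_eq_empty_iff.2 hne, Metric.diam_empty] at hdiam
    exact hΔ.ne hdiam
  have h : P.Valid := by
    subst hP
    exact ⟨hlam, hL, hq, hΔ, hX.doublingDim_nonneg, hT⟩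
  have hd : P.d = StaticGN.doublingDim X := by rw [hP]
  have hPT : P.T = T := by rw [hP]
  have hdist : ∀ a b : X, dist a b ≤ P.diam := fun a b => by
    rw [hP, ← hdiam]
    exact Metric.dist_le_diam_of_mem isCompact_univ.isBounded trivial trivial
  refine ⟨⟨rfl, StaticGN.Params.strictMonoOn_tau h, ?_⟩, fun h3 => ?_, fun U => ⟨?_, ?_⟩⟩
  · rw [← hPT]; exact StaticGN.Params.tau_lastBatch_le
  · rw [← hPT] at h3 ⊢
    rw [← hd]
    have h1 := StaticGN.Params.lastBatch_add_one_le h (by omega)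
    have h2 := StaticGN.Params.log_logRatio_le h3
    have h4 := StaticGN.Params.batchesConst_pos
    have h5 := h.d_nonneg
    exact h1.trans (by gcongr)
  · exact ⟨_, StaticGN.isStaticGN_canonicalPolicy h hX hd hdist U⟩
  · intro π hπ f xs hf Ω _ μ _ ξ seed hξ
    rcases hT.eq_or_lt with h1 | h2
    -- For `T = 1` the required probability `1 - 2 / T` is negative.
    · exact ⟨∅, MeasurableSet.empty, by rw [← h1]; norm_num, fun ω hω => absurd hω (by simp)⟩
    · have hf' : StaticGN.IsNondegenerate f P.lam P.L P.q xs := by rw [hP]; exact hf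
      have key := hπ.exists_event h (by omega) hf' hdist seed hξ
      subst hP
      exact key
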